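/- Let $R$ and $C$ denote the row and column operator space structures on $\ell_2$, i.e. $R=\mathcal B(\ell_2,\mathbb C)$ via $x\mapsto(y\mapsto\sum_k x_ky_k)$ and $C=\mathcal B(\mathbb C,\ell_2)$ via $x\mapsto(\lambda\mapsto\lambda x)$. For $1\le p\le\infty$ put, by complex interpolation of operator spaces, $R_p=[R,C]_{1/p}$ and $C_p=[C,R]_{1/p}$, and let $\mathrm{OH}=[R,C]_{1/2}$ be the operator Hilbert space. For operator spaces $\mathrm X,\mathrm Y$ let $\mathrm X\oplus_2\mathrm Y=[\mathrm X\oplus_\infty\mathrm Y,\mathrm X\oplus_1\mathrm Y]_{1/2}$ be their $\ell_2$-direct sum, and write $\mathrm X\in\mathcal{QS}(\mathrm Y)$ if $\mathrm X$ is completely isomorphic to a quotient $S/N$, where $S$ is a closed subspace of $\mathrm Y$ and $N$ a closed subspace of $S$. If $1\le p<q\le 2$, then $$R_q\in\mathcal{QS}\big(R_p\oplus_2\mathrm{OH}\big)\quad\text{and}\quad C_q\in\mathcal{QS}\big(C_p\oplus_2\mathrm{OH}\big).$$ -/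

import Mathlib

open scoped ENNReal

noncomputable section

namespace OpSpace

/-- The Hilbert space `ℓ₂` of square summable complex sequences. -/
abbrev Ell2 : Type := lp (fun _ : ℕ => ℂ) 2

/-- A family of functions on the spaces `M_n(V)` of square matrices over `V`: the data
`x ↦ ‖x‖_{M_n(V)}` of an operator space structure on the complex vector space `V`.
All the structures used below are built explicitly. -/
abbrev MatNorm (V : Type*) : Type _ :=
  ∀ n : ℕ, Matrix (Fin n) (Fin n) V → ℝ

section Concrete

variable {H K : Type*} [NormedAddCommGroup H] [InnerProductSpace ℂ H]
  [NormedAddCommGroup K] [InnerProductSpace ℂ K]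

/-- The operator `H^n → K^n` (Hilbertian direct sums) given by a matrix of operators:
`(T y)_i = ∑_j T_{ij} y_j`. -/
def blockOperator {n : ℕ} (T : Matrix (Fin n) (Fin n) (H →L[ℂ] K)) :
    PiLp 2 (fun _ : Fin n => H) →L[ℂ] PiLp 2 (fun _ : Fin n => K) :=
  (PiLp.continuousLinearEquiv 2 ℂ (fun _ : Fin n => K)).symm.toContinuousLinearMap ∘L
    ContinuousLinearMap.pi fun i =>
      ∑ j, (T i j) ∘L (PiLp.proj 2 (fun _ : Fin n => H) j : _ →L[ℂ] H)

theorem blockOperator_apply {n : ℕ} (T : Matrix (Fin n) (Fin n) (H →L[ℂ] K))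
    (y : PiLp 2 (fun _ : Fin n => H)) (i : Fin n) :
    blockOperator T y i = ∑ j, T i j (y j) := by
  simp [blockOperator]

variable (H K) in
/-- The operator space structure of `B(H, K)`: `M_n(B(H, K)) = B(H^n, K^n)`. -/
def operatorMatNorm : MatNorm (H →L[ℂ] K) := fun _ T => ‖blockOperator T‖

end Concrete

/-- The row operator `y ↦ ∑ x_k y_k` in `B(ℓ₂, ℂ)` attached to `x ∈ ℓ₂`. -/
def rowOperator (x : Ell2) : Ell2 →L[ℂ] ℂ := innerSL ℂ (star x)

theorem rowOperator_apply (x y : Ell2) : rowOperator x y = ∑' k, x k * y k := by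
  simp [rowOperator, lp.inner_eq_tsum, mul_comm]

/-- The column operator `c ↦ c x` in `B(ℂ, ℓ₂)` attached to `x ∈ ℓ₂`. -/
def columnOperator (x : Ell2) : ℂ →L[ℂ] Ell2 := ContinuousLinearMap.toSpanSingleton ℂ x

/-- The row space `R`: `ℓ₂` with the structure of `B(ℓ₂, ℂ)`. -/
def row : MatNorm Ell2 := fun n x => operatorMatNorm Ell2 ℂ n (x.map rowOperator)

/-- The column space `C`: `ℓ₂` with the structure of `B(ℂ, ℓ₂)`. -/
def column : MatNorm Ell2 := fun n x => operatorMatNorm ℂ Ell2 n (x.map columnOperator)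

/-- The closed strip `0 ≤ Re z ≤ 1`. -/
def closedStrip : Set ℂ := {z | 0 ≤ z.re ∧ z.re ≤ 1}

/-- The open strip `0 < Re z < 1`. -/
def openStrip : Set ℂ := {z | 0 < z.re ∧ z.re < 1}

/-- Complex interpolation `[X₀, X₁]_θ` (`0 ≤ θ ≤ 1`) of two operator space structures on one
space `V`, both inducing the topology of `V`, so that `X₀ + X₁ = V` and, for every `n`, the
norms of `M_n(X₀)` and `M_n(X₁)` induce the entrywise topology of `M_n(V)`. By definition
`M_n([X₀, X₁]_θ) = [M_n(X₀), M_n(X₁)]_θ`, where the norm of `x` in the latter space is the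
infimum of `max (sup_t ‖f (it)‖_{M_n(X₀)}) (sup_t ‖f (1 + it)‖_{M_n(X₁)})` over all bounded
continuous `f` on the closed strip which are analytic in the open strip and have
`f θ = x`. -/
def interpolation {V : Type*} [NormedAddCommGroup V] [NormedSpace ℂ V]
    (θ : ℝ) (X₀ X₁ : MatNorm V) : MatNorm V := fun n x =>
  sInf {M : ℝ | 0 ≤ M ∧ ∃ f : ℂ → Matrix (Fin n) (Fin n) V,
    (∀ i j, ContinuousOn (fun z => f z i j) closedStrip) ∧
    (∀ i j, DifferentiableOn ℂ (fun z => f z i j) openStrip) ∧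
    (∀ i j, ∃ B : ℝ, ∀ z ∈ closedStrip, ‖f z i j‖ ≤ B) ∧
    (∀ t : ℝ, X₀ n (f (t * Complex.I)) ≤ M) ∧
    (∀ t : ℝ, X₁ n (f (1 + t * Complex.I)) ≤ M) ∧
    f θ = x}

/-- `R_p = [R, C]_{1/p}`. -/
def rowP (p : ℝ) : MatNorm Ell2 := interpolation (1 / p) row column

/-- `C_p = [C, R]_{1/p}`. -/
def columnP (p : ℝ) : MatNorm Ell2 := interpolation (1 / p) column row

/-- The operator Hilbert space `OH = [R, C]_{1/2}`. -/
def OH : MatNorm Ell2 := interpolation (1 / 2) row column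

section General

variable {V W : Type*} [AddCommGroup V] [Module ℂ V] [AddCommGroup W] [Module ℂ W]

/-- `T` is completely contractive: `‖(T x_{ij})‖_{M_n(Y)} ≤ ‖(x_{ij})‖_{M_n(X)}` for all `n`. -/
def IsCompletelyContractive (X : MatNorm V) (Y : MatNorm W) (T : V →ₗ[ℂ] W) : Prop :=
  ∀ (n : ℕ) (x : Matrix (Fin n) (Fin n) V), Y n (x.map T) ≤ X n x

/-- `T` is completely bounded: `‖(T x_{ij})‖_{M_n(Y)} ≤ c ‖(x_{ij})‖_{M_n(X)}` with `c`
independent of `n`. -/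
def IsCompletelyBounded (X : MatNorm V) (Y : MatNorm W) (T : V →ₗ[ℂ] W) : Prop :=
  ∃ c : ℝ, ∀ (n : ℕ) (x : Matrix (Fin n) (Fin n) V), Y n (x.map T) ≤ c * X n x

/-- Complete isomorphism of operator spaces. -/
def CompletelyIsomorphic (X : MatNorm V) (Y : MatNorm W) : Prop :=
  ∃ T : V ≃ₗ[ℂ] W, IsCompletelyBounded X Y T.toLinearMap ∧
    IsCompletelyBounded Y X T.symm.toLinearMap

/-- The direct sum `X ⊕_∞ Y`. -/
def directSumInf (X : MatNorm V) (Y : MatNorm W) : MatNorm (V × W) := fun n x =>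
  max (X n (x.map Prod.fst)) (Y n (x.map Prod.snd))

/-- The direct sum `X ⊕_1 Y`: the norm of `(x, y)` in `M_n(X ⊕_1 Y)` is the supremum of
`‖(u x_{ij} + v y_{ij})‖_{M_n(B(H))}` over all completely contractive `u : X → B(H)` and
`v : Y → B(H)`. It suffices to take `H = ℓ₂`, since the norm of an operator matrix is the
supremum of the norms of its compressions to finite-dimensional subspaces of `H`. -/
def directSumOne (X : MatNorm V) (Y : MatNorm W) : MatNorm (V × W) := fun n x =>
  sSup {r : ℝ | ∃ (u : V →ₗ[ℂ] (Ell2 →L[ℂ] Ell2)) (v : W →ₗ[ℂ] (Ell2 →L[ℂ] Ell2)),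
    IsCompletelyContractive X (operatorMatNorm Ell2 Ell2) u ∧
    IsCompletelyContractive Y (operatorMatNorm Ell2 Ell2) v ∧
    r = operatorMatNorm Ell2 Ell2 n (x.map fun a => u a.1 + v a.2)}

/-- The structure inherited by a subspace: `M_n(S) ⊆ M_n(X)`. -/
def subspaceNorm (X : MatNorm V) (S : Submodule ℂ V) : MatNorm S := fun n x =>
  X n (x.map fun s => (s : V))

/-- The quotient structure: `M_n(X / N) = M_n(X) / M_n(N)`. -/
def quotientNorm (X : MatNorm V) (N : Submodule ℂ V) : MatNorm (V ⧸ N) := fun n x =>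
  sInf {r : ℝ | ∃ y : Matrix (Fin n) (Fin n) V, y.map N.mkQ = x ∧ r = X n y}

/-- `S` is closed for the norm of `X = M_1(X)`: every point of `V` which is approximated by
elements of `S` belongs to `S`. -/
def IsClosedIn (X : MatNorm V) (S : Submodule ℂ V) : Prop :=
  ∀ v : V, (∀ ε : ℝ, 0 < ε → ∃ s ∈ S, X 1 (Matrix.of fun _ _ => v - s) < ε) → v ∈ S

/-- `X ∈ QS(Y)`: `X` is completely isomorphic to a quotient `S / N` of a (closed) subspace `S`
of `Y` by a closed subspace `N` of `S`. -/
def IsQuotientOfSubspace (X : MatNorm V) (Y : MatNorm W) : Prop :=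
  ∃ S : Submodule ℂ W, IsClosedIn Y S ∧
    ∃ N : Submodule ℂ S, IsClosedIn (subspaceNorm Y S) N ∧
      CompletelyIsomorphic X (quotientNorm (subspaceNorm Y S) N)

end General

/-- The direct sum `X ⊕_2 Y = [X ⊕_∞ Y, X ⊕_1 Y]_{1/2}`. -/
def directSumTwo {V W : Type*} [NormedAddCommGroup V] [NormedSpace ℂ V]
    [NormedAddCommGroup W] [NormedSpace ℂ W] (X : MatNorm V) (Y : MatNorm W) :
    MatNorm (V × W) :=
  interpolation (1 / 2) (directSumInf X Y) (directSumOne X Y)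

end OpSpace

end

/-!
Write `X_θ = [R, C]_θ`. After a reflection of the strip, both assertions say that `X_η` is a
quotient of a subspace of `X_{θ₀} ⊕₂ X_{θ₁}` when `η` lies strictly between `θ₀` and `θ₁`, or when
`η = θ₁`; the second case (`q = 2`) is trivial, `X_{θ₁}` being a subspace of the sum.

The norm of `M_n(X_θ)` has a description which does not mention analytic functions: its square is
the supremum of `Tr (∑ᵢ xᵢ* α^(1-θ) xᵢ β^θ)` over density matrices `α`, `β` (`Dominated`). That the
supremum is at most the interpolation norm is the three lines theorem (`dominated_interpolation`).
For the converse, take `α` and `β` which attain it. The Euler–Lagrange equations say that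
`∑ᵢ xᵢ β^θ xᵢ* ≤ N α^θ` and `∑ᵢ xᵢ* α^(1-θ) xᵢ ≤ N β^(1-θ)`, with `N` the supremum
(`exists_isBalanced`), and then `z ↦ α^((z-θ)/2) x β^((θ-z)/2)` is an analytic function through `x`
whose row norm on the left line and column norm on the right line are at most `√N`
(`Dominated.interpolation_le`). The same weights produce complete contractions of `X_θ` into
matrix algebras which attain the norm of `x` (`isNormed_interpolation`). Hence the norm of
`X ⊕₁ Y` dominates the norms of both summands, and so does the norm of `X ⊕₂ Y`, up to the trace
formula (`dominated_directSumTwo`); the other estimate, by the sum of the two norms, is immediate.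

The subspace `S` is a discrete `J`-method: view `ℓ₂` as `ℓ₂(ℤ; ℓ₂)`, and let `S` be the space of
pairs `((e^(kδ₀) c_k)_k, (e^(kδ₁) c_k)_k)`, where `δᵢ = (θᵢ - η)/2`. The quotient map is
`(c_k) ↦ ∑ c_k`. In the diagonal form of the trace formula its boundedness is a scalar
Cauchy–Schwarz inequality for each entry, since `∑_k (e^(2δ₀(τ+k)) + e^(2δ₁(τ+k)))⁻¹` is bounded
uniformly in `τ` (`exists_dominated_jointSum`). To lift `x`, diagonalize the balancing weights and
round them to integral powers of `e`, say `e^(m_j)` and `e^(r_l)`; take for `c_k` the part of `x`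
in the entries with `m_j - r_l = k`. The analytic function above then passes through both
components of the lift, because cutting a matrix into such generalized diagonals, placed in
orthogonal copies of `ℓ₂`, does not increase its row and column norms (`IsBalanced.exists_lift`).
-/

noncomputable section

namespace OpSpace

/-! ### Scalar matrices acting on matrices over a Hilbert space -/

section Matrices

section Sandwich

variable {n : ℕ} {E : Type*} [AddCommGroup E] [Module ℂ E]

/-- The product `U x V` of a matrix `x` over the vector space `E` with scalar matrices. -/
def sandwich (U V : Matrix (Fin n) (Fin n) ℂ) (x : Matrix (Fin n) (Fin n) E) :
    Matrix (Fin n) (Fin n) E :=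
  Matrix.of fun j l => ∑ t, V t l • ∑ s, U j s • x s t

theorem sandwich_apply (U V : Matrix (Fin n) (Fin n) ℂ) (x : Matrix (Fin n) (Fin n) E)
    (j l : Fin n) : sandwich U V x j l = ∑ t, V t l • ∑ s, U j s • x s t := rfl

theorem sandwich_apply' (U V : Matrix (Fin n) (Fin n) ℂ) (x : Matrix (Fin n) (Fin n) E)
    (j l : Fin n) : sandwich U V x j l = ∑ s, U j s • ∑ t, V t l • x s t := by
  simp only [sandwich_apply, Finset.smul_sum]
  rw [Finset.sum_comm]
  simp only [smul_comm (U _ _)]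

theorem sandwich_transpose (U V : Matrix (Fin n) (Fin n) ℂ) (x : Matrix (Fin n) (Fin n) E) :
    (sandwich U V x).transpose = sandwich V.transpose U.transpose x.transpose := by
  ext j l
  rw [Matrix.transpose_apply, sandwich_apply, sandwich_apply']
  rfl

theorem sandwich_sandwich (U V U' V' : Matrix (Fin n) (Fin n) ℂ)
    (x : Matrix (Fin n) (Fin n) E) :
    sandwich U' V' (sandwich U V x) = sandwich (U' * U) (V * V') x := by
  ext j l
  have h : ∀ t, ∑ s, U' j s • sandwich U V x s t
      = ∑ t', V t' t • ∑ s', (U' * U) j s' • x s' t' := by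
    intro t
    simp only [sandwich_apply, Matrix.mul_apply, Finset.sum_smul, Finset.smul_sum, smul_smul]
    rw [Finset.sum_comm]
    refine Finset.sum_congr rfl fun t' _ => ?_
    rw [Finset.sum_comm]
    refine Finset.sum_congr rfl fun s _ => Finset.sum_congr rfl fun s' _ => ?_
    congr 1; ring
  rw [sandwich_apply, sandwich_apply]
  simp only [h]
  simp only [smul_smul, Finset.smul_sum (r := V' _ l)]
  rw [Finset.sum_comm]
  refine Finset.sum_congr rfl fun t _ => ?_
  rw [← Finset.sum_smul, Matrix.mul_apply]
  congr 1
  exact Finset.sum_congr rfl fun _ _ => mul_comm _ _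

theorem sandwich_one (x : Matrix (Fin n) (Fin n) E) : sandwich 1 1 x = x := by
  ext j l
  simp [sandwich_apply, Matrix.one_apply, ite_smul]

theorem sandwich_star_sandwich {U V : Matrix (Fin n) (Fin n) ℂ}
    (hU : U ∈ Matrix.unitaryGroup (Fin n) ℂ) (hV : V ∈ Matrix.unitaryGroup (Fin n) ℂ)
    (x : Matrix (Fin n) (Fin n) E) : sandwich (star U) (star V) (sandwich U V x) = x := by
  rw [sandwich_sandwich, Matrix.mem_unitaryGroup_iff'.1 hU, Matrix.mem_unitaryGroup_iff.1 hV,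
    sandwich_one]

theorem map_sandwich {F : Type*} [AddCommGroup F] [Module ℂ F]
    (T : E →ₗ[ℂ] F) (U V : Matrix (Fin n) (Fin n) ℂ) (x : Matrix (Fin n) (Fin n) E) :
    (sandwich U V x).map T = sandwich U V (x.map T) := by
  ext j l
  simp [sandwich_apply]

end Sandwich

variable {n : ℕ} {E : Type*} [NormedAddCommGroup E] [InnerProductSpace ℂ E]

/-- Unitary matrices preserve the Hilbertian norm of vectors over a Hilbert space. -/
theorem sum_norm_sq_unitary {U : Matrix (Fin n) (Fin n) ℂ}
    (hU : U ∈ Matrix.unitaryGroup (Fin n) ℂ) (y : Fin n → E) :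
    ∑ j, ‖∑ s, U j s • y s‖ ^ 2 = ∑ s, ‖y s‖ ^ 2 := by
  have key : ∀ s t, ∑ j, (starRingEnd ℂ) (U j s) * U j t = if s = t then 1 else 0 := by
    intro s t
    have := congrFun (congrFun (Matrix.mem_unitaryGroup_iff'.1 hU) s) t
    simpa [Matrix.mul_apply, Matrix.one_apply, Matrix.star_apply] using this
  have h2 : ∀ v : E, ((‖v‖ ^ 2 : ℝ) : ℂ) = inner ℂ v v := by
    intro v; rw [inner_self_eq_norm_sq_to_K]; simp
  have h : ((∑ j, ‖∑ s, U j s • y s‖ ^ 2 : ℝ) : ℂ) = ((∑ s, ‖y s‖ ^ 2 : ℝ) : ℂ) := by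
    rw [Complex.ofReal_sum, Complex.ofReal_sum]
    simp only [h2, sum_inner, inner_sum, inner_smul_left, inner_smul_right, Finset.mul_sum]
    calc ∑ j, ∑ t, ∑ s, U j t * ((starRingEnd ℂ) (U j s) * inner ℂ (y s) (y t))
        = ∑ s, ∑ t, (∑ j, (starRingEnd ℂ) (U j s) * U j t) * inner ℂ (y s) (y t) := by
          rw [Finset.sum_congr rfl fun j _ => Finset.sum_comm, Finset.sum_comm]
          refine Finset.sum_congr rfl fun s _ => ?_
          rw [Finset.sum_comm]
          refine Finset.sum_congr rfl fun t _ => ?_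
          rw [Finset.sum_mul]
          exact Finset.sum_congr rfl fun j _ => by ring
      _ = ∑ s, inner ℂ (y s) (y s) := by
          simp [key]
  exact_mod_cast h

theorem sum_norm_sq_row_eq_one {U : Matrix (Fin n) (Fin n) ℂ}
    (hU : U ∈ Matrix.unitaryGroup (Fin n) ℂ) (j : Fin n) : ∑ s, ‖U j s‖ ^ 2 = 1 := by
  have h2 := congrFun (congrFun (Matrix.mem_unitaryGroup_iff.1 hU) j) j
  rw [Matrix.mul_apply, Matrix.one_apply_eq] at h2
  have h3 : ((∑ s, ‖U j s‖ ^ 2 : ℝ) : ℂ) = 1 := by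
    rw [← h2, Complex.ofReal_sum]
    refine Finset.sum_congr rfl fun s _ => ?_
    change _ = U j s * (starRingEnd ℂ) (U j s)
    rw [Complex.mul_conj, Complex.normSq_eq_norm_sq]
  exact_mod_cast h3

theorem transpose_mem_unitaryGroup {U : Matrix (Fin n) (Fin n) ℂ}
    (hU : U ∈ Matrix.unitaryGroup (Fin n) ℂ) : U.transpose ∈ Matrix.unitaryGroup (Fin n) ℂ := by
  rw [Matrix.mem_unitaryGroup_iff]
  have h := Matrix.mem_unitaryGroup_iff'.1 hU
  have : U.transpose * star U.transpose = (star U * U).transpose := by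
    rw [Matrix.transpose_mul]; rfl
  rw [this, h, Matrix.transpose_one]

/-- `‖x‖_{M_n(R)} ≤ K`: all combinations `∑ ξ_j x_j` of the rows of `x`, with `ξ` in the unit
ball of `ℓ₂^n`, have Hilbertian norm at most `K`. -/
def RowLE (x : Matrix (Fin n) (Fin n) E) (K : ℝ) : Prop :=
  ∀ ξ : Fin n → ℂ, ∑ l, ‖∑ j, ξ j • x j l‖ ^ 2 ≤ K ^ 2 * ∑ j, ‖ξ j‖ ^ 2

theorem RowLE.sandwich {x : Matrix (Fin n) (Fin n) E} {K : ℝ} (h : RowLE x K)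
    {U V : Matrix (Fin n) (Fin n) ℂ} (hU : U ∈ Matrix.unitaryGroup (Fin n) ℂ)
    (hV : V ∈ Matrix.unitaryGroup (Fin n) ℂ) : RowLE (sandwich U V x) K := by
  intro ξ
  have h1 : ∀ l, ∑ j, ξ j • OpSpace.sandwich U V x j l
      = ∑ t, V.transpose l t • ∑ s, (∑ j, U.transpose s j • ξ j) • x s t := by
    intro l
    simp only [sandwich_apply, Finset.smul_sum, Finset.sum_smul, smul_smul, Matrix.transpose_apply,
      smul_eq_mul]
    rw [Finset.sum_comm]
    refine Finset.sum_congr rfl fun t _ => ?_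
    rw [Finset.sum_comm]
    refine Finset.sum_congr rfl fun s _ => Finset.sum_congr rfl fun j _ => ?_
    congr 1; ring
  simp only [h1]
  rw [sum_norm_sq_unitary (transpose_mem_unitaryGroup hV),
    ← sum_norm_sq_unitary (transpose_mem_unitaryGroup hU) ξ]
  exact h _

theorem RowLE.sandwich_transpose {x : Matrix (Fin n) (Fin n) E} {K : ℝ}
    (h : RowLE x.transpose K)
    {U V : Matrix (Fin n) (Fin n) ℂ} (hU : U ∈ Matrix.unitaryGroup (Fin n) ℂ)
    (hV : V ∈ Matrix.unitaryGroup (Fin n) ℂ) :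
    RowLE (OpSpace.sandwich U V x).transpose K := by
  rw [OpSpace.sandwich_transpose]
  exact h.sandwich (transpose_mem_unitaryGroup hV) (transpose_mem_unitaryGroup hU)

/-- The single row case of the bound: `∑_l ‖x_{jl}‖² ≤ K²`. -/
theorem RowLE.single {x : Matrix (Fin n) (Fin n) E} {K : ℝ} (h : RowLE x K) (j : Fin n) :
    ∑ l, ‖x j l‖ ^ 2 ≤ K ^ 2 := by
  have := h (Pi.single j 1)
  have h2 : ∀ i : Fin n, ‖(Pi.single j (1 : ℂ) : Fin n → ℂ) i‖ ^ 2 = if i = j then 1 else 0 := by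
    intro i; by_cases hi : i = j
    · subst hi; simp
    · simp [hi]
  have h3 : ∀ l, ∑ i, (Pi.single j (1 : ℂ) : Fin n → ℂ) i • x i l = x j l := by
    intro l
    rw [Finset.sum_eq_single j]
    · simp
    · intro b _ hb; simp [hb]
    · simp
  simpa [h2, h3] using this

/-- The pairing behind the duality of the row and the column space: a matrix bounded in
`M_m(R)` and a matrix bounded in `M_n(C)` pair to an operator on `ℂ^m ⊗ ℂ^n`. -/
theorem norm_pairing_le {m : ℕ} {f : Matrix (Fin m) (Fin m) E} {y : Matrix (Fin n) (Fin n) E}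
    {K L : ℝ} (hK : 0 ≤ K) (hL : 0 ≤ L) (hf : RowLE f K) (hy : RowLE y.transpose L)
    (ζ ξ : Fin m → Fin n → ℂ) :
    ‖∑ s, ∑ t, ∑ p, ∑ q, ζ s p * ξ t q * inner ℂ (y p q) (f s t)‖ ≤
      K * L * (√(∑ s, ∑ p, ‖ζ s p‖ ^ 2) * √(∑ t, ∑ q, ‖ξ t q‖ ^ 2)) := by
  set Y : Fin n → Fin m → E := fun p t => ∑ q, (starRingEnd ℂ) (ξ t q) • y p q
  set Z : Fin n → Fin m → E := fun p t => ∑ s, ζ s p • f s t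
  have h1 : ∑ s, ∑ t, ∑ p, ∑ q, ζ s p * ξ t q * inner ℂ (y p q) (f s t)
      = ∑ x : Fin n × Fin m, inner ℂ (Y x.1 x.2) (Z x.1 x.2) := by
    rw [Fintype.sum_prod_type]
    simp only [Y, Z, sum_inner, inner_sum, inner_smul_left, inner_smul_right, Complex.conj_conj]
    calc _ = ∑ s, ∑ p, ∑ t, ∑ q, ζ s p * ξ t q * inner ℂ (y p q) (f s t) :=
          Finset.sum_congr rfl fun s _ => by rw [Finset.sum_comm]
      _ = ∑ p, ∑ s, ∑ t, ∑ q, ζ s p * ξ t q * inner ℂ (y p q) (f s t) := Finset.sum_comm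
      _ = _ := by
        refine Finset.sum_congr rfl fun p _ => ?_
        rw [Finset.sum_comm]
        refine Finset.sum_congr rfl fun t _ => ?_
        refine Finset.sum_congr rfl fun s _ => ?_
        rw [Finset.mul_sum]
        exact Finset.sum_congr rfl fun q _ => mul_assoc _ _ _
  have hY : ∑ x : Fin n × Fin m, ‖Y x.1 x.2‖ ^ 2 ≤ L ^ 2 * ∑ t, ∑ q, ‖ξ t q‖ ^ 2 := by
    rw [Fintype.sum_prod_type_right, Finset.mul_sum]
    refine Finset.sum_le_sum fun t _ => ?_
    simpa [Y] using hy (fun q => (starRingEnd ℂ) (ξ t q))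
  have hZ : ∑ x : Fin n × Fin m, ‖Z x.1 x.2‖ ^ 2 ≤ K ^ 2 * ∑ s, ∑ p, ‖ζ s p‖ ^ 2 := by
    rw [Fintype.sum_prod_type, Finset.sum_comm (s := Finset.univ (α := Fin m)), Finset.mul_sum]
    exact Finset.sum_le_sum fun p _ => hf (fun s => ζ s p)
  rw [h1]
  calc ‖∑ x : Fin n × Fin m, inner ℂ (Y x.1 x.2) (Z x.1 x.2)‖
      ≤ ∑ x : Fin n × Fin m, ‖Y x.1 x.2‖ * ‖Z x.1 x.2‖ :=
        (norm_sum_le _ _).trans (Finset.sum_le_sum fun _ _ => norm_inner_le_norm _ _)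
    _ ≤ √(∑ x : Fin n × Fin m, ‖Y x.1 x.2‖ ^ 2) * √(∑ x : Fin n × Fin m, ‖Z x.1 x.2‖ ^ 2) :=
        Real.sum_mul_le_sqrt_mul_sqrt _ _ _
    _ ≤ √(L ^ 2 * ∑ t, ∑ q, ‖ξ t q‖ ^ 2) * √(K ^ 2 * ∑ s, ∑ p, ‖ζ s p‖ ^ 2) := by gcongr
    _ = _ := by
        rw [Real.sqrt_mul (sq_nonneg _), Real.sqrt_mul (sq_nonneg _), Real.sqrt_sq hK,
          Real.sqrt_sq hL]
        ring

end Matrices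

/-! ### The row and column norms -/

theorem column_le_iff {n : ℕ} {x : Matrix (Fin n) (Fin n) Ell2} {K : ℝ} (hK : 0 ≤ K) :
    column n x ≤ K ↔ RowLE x.transpose K := by
  have h1 : ∀ c : PiLp 2 (fun _ : Fin n => ℂ),
      ‖blockOperator (x.map columnOperator) c‖ ^ 2 = ∑ j, ‖∑ l, c l • x j l‖ ^ 2 := by
    intro c
    rw [PiLp.norm_sq_eq_of_L2]
    simp [blockOperator_apply, columnOperator]
  have h2 : ∀ c : PiLp 2 (fun _ : Fin n => ℂ), (K * ‖c‖) ^ 2 = K ^ 2 * ∑ l, ‖c l‖ ^ 2 := by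
    intro c
    rw [mul_pow, PiLp.norm_sq_eq_of_L2]
  constructor
  · intro h ξ
    have := (blockOperator (x.map columnOperator)).le_of_opNorm_le h (WithLp.toLp 2 ξ)
    have := pow_le_pow_left₀ (norm_nonneg _) this 2
    rw [h1, h2] at this
    exact this
  · intro h
    refine ContinuousLinearMap.opNorm_le_bound _ hK fun c => ?_
    refine (sq_le_sq₀ (norm_nonneg _) (by positivity)).1 ?_
    rw [h1, h2]
    exact h c

theorem inner_star_eq (x y : Ell2) : inner ℂ (star x) y = rowOperator x y := rfl

theorem rowOperator_sum_smul {n : ℕ} (ξ : Fin n → ℂ) (x : Fin n → Ell2) (y : Ell2) :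
    rowOperator (∑ j, ξ j • x j) y = ∑ j, ξ j * rowOperator (x j) y := by
  simp only [rowOperator, innerSL_apply_apply, star_sum, star_smul, sum_inner, inner_smul_left]
  simp

theorem row_le_iff {n : ℕ} {x : Matrix (Fin n) (Fin n) Ell2} {K : ℝ} (hK : 0 ≤ K) :
    row n x ≤ K ↔ RowLE x K := by
  have h1 : ∀ (ξ : Fin n → ℂ) (y : PiLp 2 (fun _ : Fin n => Ell2)),
      ∑ j, ξ j * blockOperator (x.map rowOperator) y j
        = ∑ l, rowOperator (∑ j, ξ j • x j l) (y l) := by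
    intro ξ y
    simp only [blockOperator_apply, Matrix.map_apply, rowOperator_sum_smul, Finset.mul_sum]
    rw [Finset.sum_comm]
  constructor
  · intro h ξ
    set y : PiLp 2 (fun _ : Fin n => Ell2) := WithLp.toLp 2 fun l => star (∑ j, ξ j • x j l)
    have hy : ‖y‖ ^ 2 = ∑ l, ‖∑ j, ξ j • x j l‖ ^ 2 := by
      rw [PiLp.norm_sq_eq_of_L2]
      simp only [y, norm_star]
    have h3 := (blockOperator (x.map rowOperator)).le_of_opNorm_le h y
    have h2 : ‖y‖ ^ 2 ≤ √(∑ j, ‖ξ j‖ ^ 2) * (K * ‖y‖) := by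
      have e : ((‖y‖ ^ 2 : ℝ) : ℂ) = ∑ j, ξ j * blockOperator (x.map rowOperator) y j := by
        rw [h1, hy, Complex.ofReal_sum]
        refine Finset.sum_congr rfl fun l _ => ?_
        rw [← inner_star_eq]
        change _ = inner ℂ (star (∑ j, ξ j • x j l)) (star (∑ j, ξ j • x j l))
        rw [inner_self_eq_norm_sq_to_K, norm_star]
        simp
      have e2 : ‖y‖ ^ 2 = ‖∑ j, ξ j * blockOperator (x.map rowOperator) y j‖ := by
        rw [← e, Complex.norm_real, Real.norm_of_nonneg (by positivity)]
      rw [e2]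
      refine (norm_sum_le _ _).trans ?_
      simp only [norm_mul]
      refine (Real.sum_mul_le_sqrt_mul_sqrt _ _ _).trans ?_
      rw [← EuclideanSpace.norm_eq (blockOperator (x.map rowOperator) y)]
      gcongr
    rw [← hy]
    have h4 : ‖y‖ ≤ √(∑ j, ‖ξ j‖ ^ 2) * K := by
      by_contra! hlt
      have : 0 < ‖y‖ := lt_of_le_of_lt (by positivity) hlt
      nlinarith
    calc ‖y‖ ^ 2 ≤ (√(∑ j, ‖ξ j‖ ^ 2) * K) ^ 2 := by gcongr
      _ = _ := by rw [mul_pow, Real.sq_sqrt (by positivity)]; ring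
  · intro h
    refine ContinuousLinearMap.opNorm_le_bound _ hK fun y => ?_
    set w := blockOperator (x.map rowOperator) y
    set ξ : Fin n → ℂ := fun j => (starRingEnd ℂ) (w j)
    have hξ : ∑ j, ‖ξ j‖ ^ 2 = ‖w‖ ^ 2 := by
      rw [PiLp.norm_sq_eq_of_L2]; simp [ξ]
    have e : ((‖w‖ ^ 2 : ℝ) : ℂ) = ∑ l, rowOperator (∑ j, ξ j • x j l) (y l) := by
      rw [← h1, PiLp.norm_sq_eq_of_L2, Complex.ofReal_sum]
      refine Finset.sum_congr rfl fun j _ => ?_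
      simp only [ξ]
      rw [mul_comm, Complex.mul_conj, Complex.normSq_eq_norm_sq]
    have h2 : ‖w‖ ^ 2 ≤ (K * ‖w‖) * ‖y‖ := by
      have e2 : ‖w‖ ^ 2 = ‖∑ l, rowOperator (∑ j, ξ j • x j l) (y l)‖ := by
        rw [← e, Complex.norm_real, Real.norm_of_nonneg (by positivity)]
      rw [e2]
      calc _ ≤ ∑ l, ‖∑ j, ξ j • x j l‖ * ‖y l‖ := by
            refine (norm_sum_le _ _).trans (Finset.sum_le_sum fun l _ => ?_)
            rw [← inner_star_eq]
            exact (norm_inner_le_norm _ _).trans (by rw [norm_star])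
        _ ≤ √(∑ l, ‖∑ j, ξ j • x j l‖ ^ 2) * √(∑ l, ‖y l‖ ^ 2) :=
            Real.sum_mul_le_sqrt_mul_sqrt _ _ _
        _ ≤ √(K ^ 2 * ∑ j, ‖ξ j‖ ^ 2) * ‖y‖ := by
            rw [← PiLp.norm_sq_eq_of_L2 (fun _ : Fin n => Ell2) y, Real.sqrt_sq (norm_nonneg y)]
            gcongr
            exact h ξ
        _ = _ := by
            rw [hξ, ← mul_pow, Real.sqrt_sq (by positivity)]
    by_contra! hlt
    have : 0 < ‖w‖ := lt_of_le_of_lt (by positivity) hlt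
    nlinarith

theorem row_nonneg (n : ℕ) (x : Matrix (Fin n) (Fin n) Ell2) : 0 ≤ row n x := norm_nonneg _

theorem column_nonneg (n : ℕ) (x : Matrix (Fin n) (Fin n) Ell2) : 0 ≤ column n x :=
  norm_nonneg _

/-! ### Analytic functions on the strip -/

/-- The maximum principle on the strip, for bounded functions. -/
theorem norm_le_of_strip {E : Type*} [NormedAddCommGroup E] [NormedSpace ℂ E] {f : ℂ → E}
    {M : ℝ} (hc : ContinuousOn f closedStrip) (hd : DifferentiableOn ℂ f openStrip)
    (hb : ∃ B : ℝ, ∀ z ∈ closedStrip, ‖f z‖ ≤ B)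
    (h0 : ∀ t : ℝ, ‖f (t * Complex.I)‖ ≤ M) (h1 : ∀ t : ℝ, ‖f (1 + t * Complex.I)‖ ≤ M)
    {z : ℂ} (hz : z ∈ closedStrip) : ‖f z‖ ≤ M := by
  have hM : 0 ≤ M := (norm_nonneg _).trans (h0 0)
  have hd' : DiffContOnCl ℂ f (Complex.HadamardThreeLines.verticalStrip 0 1) := by
    refine ⟨hd, ?_⟩
    rw [Complex.HadamardThreeLines.verticalStrip, Complex.closure_preimage_re,
      closure_Ioo zero_ne_one]
    exact hc
  refine le_of_forall_pos_le_add fun ε hε => ?_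
  have key := Complex.HadamardThreeLines.norm_le_interp_of_mem_verticalClosedStrip₀₁' f
    (a := M + ε) (b := M + ε) (z := z) hz hd' ?_ ?_ ?_
  · rwa [← Real.rpow_add (by positivity), sub_add_cancel, Real.rpow_one] at key
  · obtain ⟨B, hB⟩ := hb
    refine ⟨B, ?_⟩
    rintro _ ⟨w, hw, rfl⟩
    exact hB w hw
  · intro w hw
    have : w = w.im * Complex.I := by
      apply Complex.ext <;> simp; exact hw
    rw [this]
    linarith [h0 w.im]
  · intro w hw
    have : w = 1 + w.im * Complex.I := by
      apply Complex.ext <;> simp; exact hw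
    rw [this]
    linarith [h1 w.im]

section Interpolation

variable {V : Type*} [NormedAddCommGroup V] [NormedSpace ℂ V] {n : ℕ}

/-- The matrix valued functions admitted in the definition of the complex interpolation norm:
bounded and continuous on the closed strip, analytic inside. -/
structure IsStripFunction (f : ℂ → Matrix (Fin n) (Fin n) V) : Prop where
  continuousOn : ∀ i j, ContinuousOn (fun z => f z i j) closedStrip
  differentiableOn : ∀ i j, DifferentiableOn ℂ (fun z => f z i j) openStrip
  bounded : ∀ i j, ∃ B : ℝ, ∀ z ∈ closedStrip, ‖f z i j‖ ≤ B

theorem isStripFunction_const (x : Matrix (Fin n) (Fin n) V) :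
    IsStripFunction fun _ : ℂ => x :=
  ⟨fun _ _ => continuousOn_const, fun _ _ => differentiableOn_const _,
    fun i j => ⟨‖x i j‖, fun _ _ => le_rfl⟩⟩

theorem interpolation_nonneg (θ : ℝ) (X₀ X₁ : MatNorm V) (x : Matrix (Fin n) (Fin n) V) :
    0 ≤ interpolation θ X₀ X₁ n x := Real.sInf_nonneg fun _ h => h.1

theorem interpolation_le {θ : ℝ} {X₀ X₁ : MatNorm V} {f : ℂ → Matrix (Fin n) (Fin n) V}
    (hf : IsStripFunction f) {M : ℝ} (hM : 0 ≤ M) (h0 : ∀ t : ℝ, X₀ n (f (t * Complex.I)) ≤ M)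
    (h1 : ∀ t : ℝ, X₁ n (f (1 + t * Complex.I)) ≤ M) : interpolation θ X₀ X₁ n (f θ) ≤ M :=
  csInf_le ⟨0, fun _ h => h.1⟩
    ⟨hM, f, hf.continuousOn, hf.differentiableOn, hf.bounded, h0, h1, rfl⟩

/-- The interpolation norm is an infimum over a nonempty set, which contains the bounds of the
constant function. -/
theorem exists_isStripFunction {θ : ℝ} {X₀ X₁ : MatNorm V} {x : Matrix (Fin n) (Fin n) V}
    {M : ℝ} (hM : interpolation θ X₀ X₁ n x < M) :
    ∃ f : ℂ → Matrix (Fin n) (Fin n) V, IsStripFunction f ∧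
      (∀ t : ℝ, X₀ n (f (t * Complex.I)) ≤ M) ∧ (∀ t : ℝ, X₁ n (f (1 + t * Complex.I)) ≤ M) ∧
      f θ = x := by
  have hne : {M : ℝ | 0 ≤ M ∧ ∃ f : ℂ → Matrix (Fin n) (Fin n) V,
    (∀ i j, ContinuousOn (fun z => f z i j) closedStrip) ∧
    (∀ i j, DifferentiableOn ℂ (fun z => f z i j) openStrip) ∧
    (∀ i j, ∃ B : ℝ, ∀ z ∈ closedStrip, ‖f z i j‖ ≤ B) ∧
    (∀ t : ℝ, X₀ n (f (t * Complex.I)) ≤ M) ∧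
    (∀ t : ℝ, X₁ n (f (1 + t * Complex.I)) ≤ M) ∧
    f θ = x}.Nonempty := by
    obtain ⟨h1, h2, h3⟩ := isStripFunction_const x
    exact ⟨max 0 (max (X₀ n x) (X₁ n x)), le_max_left _ _, fun _ => x, h1, h2, h3,
      fun _ => by simp, fun _ => by simp, rfl⟩
  obtain ⟨M', ⟨_, f, h1, h2, h3, h4, h5, h6⟩, hlt⟩ := exists_lt_of_csInf_lt hne hM
  exact ⟨f, ⟨h1, h2, h3⟩, fun t => (h4 t).trans hlt.le, fun t => (h5 t).trans hlt.le, h6⟩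

/-- Reflecting the strip exchanges the roles of the end points. -/
theorem interpolation_one_sub (θ : ℝ) (X₀ X₁ : MatNorm V) :
    interpolation (1 - θ) X₁ X₀ = interpolation θ X₀ X₁ := by
  have key : ∀ (θ : ℝ) (X₀ X₁ : MatNorm V) (n : ℕ) (x : Matrix (Fin n) (Fin n) V),
      interpolation (1 - θ) X₁ X₀ n x ≤ interpolation θ X₀ X₁ n x := by
    intro θ X₀ X₁ n x
    refine le_of_forall_gt fun M hM => ?_
    obtain ⟨M', hM', hlt⟩ := exists_between hM
    obtain ⟨f, hf, h0, h1, rfl⟩ := exists_isStripFunction hM'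
    have hm : Set.MapsTo (fun z : ℂ => 1 - z) closedStrip closedStrip := by
      intro z hz
      simp only [closedStrip, Set.mem_ofPred_eq, Complex.sub_re, Complex.one_re] at hz ⊢
      constructor <;> linarith [hz.1, hz.2]
    have hm' : Set.MapsTo (fun z : ℂ => 1 - z) openStrip openStrip := by
      intro z hz
      simp only [openStrip, Set.mem_ofPred_eq, Complex.sub_re, Complex.one_re] at hz ⊢
      constructor <;> linarith [hz.1, hz.2]
    have hg : IsStripFunction fun z => f (1 - z) := by
      refine ⟨fun i j => (hf.continuousOn i j).comp (by fun_prop) hm,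
        fun i j => (hf.differentiableOn i j).comp (by fun_prop) hm', fun i j => ?_⟩
      obtain ⟨B, hB⟩ := hf.bounded i j
      exact ⟨B, fun z hz => hB _ (hm hz)⟩
    refine lt_of_le_of_lt ?_ hlt
    have := interpolation_le (θ := 1 - θ) (X₀ := X₁) (X₁ := X₀) hg
      ((interpolation_nonneg _ _ _ _).trans hM'.le)
      (fun t => ?_) (fun t => ?_)
    · simpa using this
    · have := h1 (-t)
      rwa [show (1 : ℂ) + ((-t : ℝ) : ℂ) * Complex.I = 1 - t * Complex.I by push_cast; ring] at this
    · have := h0 (-t)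
      rwa [show ((-t : ℝ) : ℂ) * Complex.I = 1 - (1 + t * Complex.I) by push_cast; ring] at this
  funext n x
  refine le_antisymm (key _ _ _ _ _) ?_
  have := key (1 - θ) X₁ X₀ n x
  rwa [sub_sub_cancel] at this

end Interpolation

theorem ofReal_mem_closedStrip {θ : ℝ} (h0 : 0 ≤ θ) (h1 : θ ≤ 1) : (θ : ℂ) ∈ closedStrip := by
  simp [closedStrip, h0, h1]

section StripFunctions

variable {n : ℕ} {E : Type*} [NormedAddCommGroup E] [InnerProductSpace ℂ E]

theorem norm_cexp_affine (α β : ℝ) (z : ℂ) :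
    ‖Complex.exp (α + β * z)‖ = Real.exp (α + β * z.re) := by
  rw [Complex.norm_exp]; simp

theorem norm_cexp_affine_left (α β t : ℝ) :
    ‖Complex.exp (α + β * (t * Complex.I))‖ = Real.exp α := by
  rw [norm_cexp_affine]; simp

theorem norm_cexp_affine_right (α β t : ℝ) :
    ‖Complex.exp (α + β * (1 + t * Complex.I))‖ = Real.exp (α + β) := by
  rw [norm_cexp_affine]; simp

theorem norm_cexp_affine_le (α β : ℝ) {z : ℂ} (hz : z ∈ closedStrip) :
    ‖Complex.exp (α + β * z)‖ ≤ Real.exp (|α| + |β|) := by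
  rw [norm_cexp_affine]
  refine Real.exp_le_exp.2 (add_le_add (le_abs_self α) ?_)
  calc β * z.re ≤ |β| * z.re := mul_le_mul_of_nonneg_right (le_abs_self β) hz.1
    _ ≤ |β| := mul_le_of_le_one_right (abs_nonneg β) hz.2

/-- Entrywise multiplication by exponentials of real affine functions of `z`. -/
theorem IsStripFunction.exp_smul {f : ℂ → Matrix (Fin n) (Fin n) E} (hf : IsStripFunction f)
    (α β : Fin n → Fin n → ℝ) :
    IsStripFunction fun z => Matrix.of fun j l => Complex.exp (α j l + β j l * z) • f z j l := by
  refine ⟨fun i j => ?_, fun i j => ?_, fun i j => ?_⟩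
  · have : ContinuousOn (fun z : ℂ => Complex.exp (α i j + β i j * z)) closedStrip := by fun_prop
    exact this.smul (hf.continuousOn i j)
  · have : DifferentiableOn ℂ (fun z : ℂ => Complex.exp (α i j + β i j * z)) openStrip := by
      fun_prop
    exact this.smul (hf.differentiableOn i j)
  · obtain ⟨B, hB⟩ := hf.bounded i j
    refine ⟨Real.exp (|α i j| + |β i j|) * B, fun z hz => ?_⟩
    rw [Matrix.of_apply, norm_smul]
    exact mul_le_mul (norm_cexp_affine_le _ _ hz) (hB z hz) (norm_nonneg _) (by positivity)

theorem IsStripFunction.sandwich {f : ℂ → Matrix (Fin n) (Fin n) E} (hf : IsStripFunction f)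
    (U V : Matrix (Fin n) (Fin n) ℂ) : IsStripFunction fun z => OpSpace.sandwich U V (f z) := by
  refine ⟨fun i j => ?_, fun i j => ?_, fun i j => ?_⟩
  · simp only [sandwich_apply]
    exact continuousOn_finsetSum _ fun t _ => (continuousOn_finsetSum _ fun s _ =>
      (hf.continuousOn s t).const_smul (U i s)).const_smul (V t j)
  · simp only [sandwich_apply]
    exact DifferentiableOn.fun_sum fun t _ => (DifferentiableOn.fun_sum fun s _ =>
      (hf.differentiableOn s t).const_smul (U i s)).const_smul (V t j)
  · choose B hB using hf.bounded
    refine ⟨∑ t, ‖V t j‖ * ∑ s, ‖U i s‖ * B s t, fun z hz => ?_⟩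
    rw [sandwich_apply]
    refine (norm_sum_le _ _).trans (Finset.sum_le_sum fun t _ => ?_)
    rw [norm_smul]
    refine mul_le_mul_of_nonneg_left ?_ (norm_nonneg _)
    refine (norm_sum_le _ _).trans (Finset.sum_le_sum fun s _ => ?_)
    rw [norm_smul]
    exact mul_le_mul_of_nonneg_left (hB s t z hz) (norm_nonneg _)

theorem IsStripFunction.map {V W : Type*} [NormedAddCommGroup V] [NormedSpace ℂ V]
    [NormedAddCommGroup W] [NormedSpace ℂ W]
    {f : ℂ → Matrix (Fin n) (Fin n) V} (hf : IsStripFunction f)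
    (T : V →L[ℂ] W) : IsStripFunction fun z => (f z).map T := by
  refine ⟨fun i j => T.continuous.comp_continuousOn (hf.continuousOn i j),
    fun i j => T.differentiable.comp_differentiableOn (hf.differentiableOn i j), fun i j => ?_⟩
  obtain ⟨B, hB⟩ := hf.bounded i j
  exact ⟨‖T‖ * B, fun z hz => (T.le_opNorm _).trans
    (mul_le_mul_of_nonneg_left (hB z hz) (norm_nonneg _))⟩

/-- The maximum principle on the strip for the Hilbert–Schmidt norm. -/
theorem IsStripFunction.sum_norm_sq_le {f : ℂ → Matrix (Fin n) (Fin n) E}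
    (hf : IsStripFunction f) {M : ℝ} (hM : 0 ≤ M)
    (h0 : ∀ t : ℝ, ∑ j, ∑ l, ‖f (t * Complex.I) j l‖ ^ 2 ≤ M ^ 2)
    (h1 : ∀ t : ℝ, ∑ j, ∑ l, ‖f (1 + t * Complex.I) j l‖ ^ 2 ≤ M ^ 2)
    {z : ℂ} (hz : z ∈ closedStrip) : ∑ j, ∑ l, ‖f z j l‖ ^ 2 ≤ M ^ 2 := by
  set g : ℂ → PiLp 2 (fun _ : Fin n × Fin n => E) := fun z => WithLp.toLp 2 fun p => f z p.1 p.2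
  have hg : ∀ z, ‖g z‖ ^ 2 = ∑ j, ∑ l, ‖f z j l‖ ^ 2 := by
    intro z
    rw [PiLp.norm_sq_eq_of_L2, Fintype.sum_prod_type]
  have hg' : ∀ z, ‖g z‖ ≤ M ↔ ∑ j, ∑ l, ‖f z j l‖ ^ 2 ≤ M ^ 2 := by
    intro z
    rw [← hg, sq_le_sq₀ (norm_nonneg _) hM]
  rw [← hg']
  refine norm_le_of_strip ?_ ?_ ?_ (fun t => (hg' _).2 (h0 t)) (fun t => (hg' _).2 (h1 t)) hz
  · exact (PiLp.continuous_toLp 2 _).comp_continuousOn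
      (continuousOn_pi.2 fun p => hf.continuousOn p.1 p.2)
  · exact (PiLp.continuousLinearEquiv 2 ℂ (fun _ : Fin n × Fin n => E)).symm.differentiable
      |>.comp_differentiableOn (differentiableOn_pi.2 fun p => hf.differentiableOn p.1 p.2)
  · choose B hB using hf.bounded
    refine ⟨√(∑ j, ∑ l, B j l ^ 2), fun z hz => ?_⟩
    refine Real.le_sqrt_of_sq_le ?_
    rw [hg]
    exact Finset.sum_le_sum fun j _ => Finset.sum_le_sum fun l _ =>
      pow_le_pow_left₀ (norm_nonneg _) (hB j l z hz) 2

end StripFunctions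

/-! ### The trace formula for the interpolation norms: lower bound -/

section Dominated

variable {n : ℕ} {E : Type*} [NormedAddCommGroup E] [InnerProductSpace ℂ E]

/-- `Tr (∑ᵢ xᵢ* α^(1-θ) xᵢ β^θ) ≤ M²` for all density matrices `α`, `β`, where `xᵢ` are the
scalar matrices of the coordinates of `x`. The densities are written in diagonal form,
`α = U* diag(a) U` and `β = V diag(b) V*`, with positive eigenvalues and trace at most one. -/
def Dominated (θ : ℝ) (x : Matrix (Fin n) (Fin n) E) (M : ℝ) : Prop :=
  ∀ U ∈ Matrix.unitaryGroup (Fin n) ℂ, ∀ V ∈ Matrix.unitaryGroup (Fin n) ℂ,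
    ∀ a b : Fin n → ℝ, (∀ j, 0 < a j) → (∀ l, 0 < b l) → ∑ j, a j ≤ 1 → ∑ l, b l ≤ 1 →
      ∑ j, ∑ l, a j ^ (1 - θ) * b l ^ θ * ‖sandwich U V x j l‖ ^ 2 ≤ M ^ 2

/-- At `θ = 0` the trace bound is a bound for the row norm. -/
theorem RowLE.dominated {x : Matrix (Fin n) (Fin n) E} {M : ℝ} (h : RowLE x M) :
    Dominated 0 x M := by
  intro U hU V hV a b ha _ hs _
  have := fun j => (h.sandwich hU hV).single j
  calc _ = ∑ j, a j * ∑ l, ‖OpSpace.sandwich U V x j l‖ ^ 2 := by simp [Finset.mul_sum]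
    _ ≤ ∑ j, a j * M ^ 2 := Finset.sum_le_sum fun j _ =>
        mul_le_mul_of_nonneg_left (this j) (ha j).le
    _ ≤ M ^ 2 := by
      rw [← Finset.sum_mul]; exact mul_le_of_le_one_left (sq_nonneg _) hs

theorem Dominated.transpose {θ : ℝ} {x : Matrix (Fin n) (Fin n) E} {M : ℝ}
    (h : Dominated θ x M) : Dominated (1 - θ) x.transpose M := by
  intro U hU V hV a b ha hb hsa hsb
  have := h _ (transpose_mem_unitaryGroup hV) _ (transpose_mem_unitaryGroup hU) b a hb ha hsb hsa
  rw [Finset.sum_comm] at this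
  refine le_trans (le_of_eq ?_) this
  refine Finset.sum_congr rfl fun j _ => Finset.sum_congr rfl fun l _ => ?_
  have e := congrFun (congrFun (sandwich_transpose U V x.transpose) l) j
  rw [Matrix.transpose_transpose, Matrix.transpose_apply] at e
  rw [e, sub_sub_cancel]
  ring

theorem RowLE.dominated_transpose {x : Matrix (Fin n) (Fin n) E} {M : ℝ}
    (h : RowLE x.transpose M) : Dominated 1 x M := by
  have := h.dominated.transpose
  rwa [Matrix.transpose_transpose, sub_zero] at this

theorem exp_log_sq {a b : ℝ} (ha : 0 < a) (hb : 0 < b) (r s : ℝ) :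
    Real.exp (Real.log a / 2 * r + Real.log b / 2 * s) ^ 2 = a ^ r * b ^ s := by
  rw [← Real.exp_nat_mul, Real.rpow_def_of_pos ha, Real.rpow_def_of_pos hb, ← Real.exp_add]
  congr 1; push_cast; ring

/-- Interpolation of the trace bounds between the two ends of the strip, with exponents
`θ₀ + z (θ₁ - θ₀)`. -/
theorem IsStripFunction.dominated {f : ℂ → Matrix (Fin n) (Fin n) E} (hf : IsStripFunction f)
    {M : ℝ} (hM : 0 ≤ M) {θ₀ θ₁ : ℝ} (h0 : ∀ t : ℝ, Dominated θ₀ (f (t * Complex.I)) M)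
    (h1 : ∀ t : ℝ, Dominated θ₁ (f (1 + t * Complex.I)) M) {θ : ℝ} (hθ0 : 0 ≤ θ) (hθ1 : θ ≤ 1) :
    Dominated (θ₀ + θ * (θ₁ - θ₀)) (f θ) M := by
  intro U hU V hV a b ha hb hsa hsb
  -- the weights `a^((1-ϑ)/2) b^(ϑ/2)`, `ϑ = θ₀ + z (θ₁ - θ₀)`, as exponentials of `z`
  set α : Fin n → Fin n → ℝ := fun j l =>
    Real.log (a j) / 2 * (1 - θ₀) + Real.log (b l) / 2 * θ₀
  set β : Fin n → Fin n → ℝ := fun j l =>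
    Real.log (a j) / 2 * (-(θ₁ - θ₀)) + Real.log (b l) / 2 * (θ₁ - θ₀)
  have hg := (hf.sandwich U V).exp_smul α β
  have key : ∀ z : ℂ,
      ∑ j, ∑ l, ‖Complex.exp (α j l + β j l * z) • OpSpace.sandwich U V (f z) j l‖ ^ 2
      = ∑ j, ∑ l, a j ^ (1 - (θ₀ + z.re * (θ₁ - θ₀))) * b l ^ (θ₀ + z.re * (θ₁ - θ₀)) *
        ‖OpSpace.sandwich U V (f z) j l‖ ^ 2 := by
    intro z
    refine Finset.sum_congr rfl fun j _ => Finset.sum_congr rfl fun l _ => ?_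
    rw [norm_smul, mul_pow, norm_cexp_affine, ← exp_log_sq (ha j) (hb l)]
    congr 3
    simp only [α, β]; ring
  have := hg.sum_norm_sq_le hM (fun t => ?_) (fun t => ?_) (ofReal_mem_closedStrip hθ0 hθ1)
  · simp only [Matrix.of_apply, key, Complex.ofReal_re] at this
    exact this
  · simp only [Matrix.of_apply, key]
    simpa using h0 t U hU V hV a b ha hb hsa hsb
  · simp only [Matrix.of_apply, key]
    simpa using h1 t U hU V hV a b ha hb hsa hsb

theorem Dominated.of_forall_gt {θ : ℝ} {x : Matrix (Fin n) (Fin n) E} {M : ℝ}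
    (h : ∀ M' > M, Dominated θ x M') : Dominated θ x M := by
  intro U hU V hV a b ha hb hsa hsb
  have hc : Filter.Tendsto (fun M' : ℝ => M' ^ 2) (nhdsWithin M (Set.Ioi M)) (nhds (M ^ 2)) :=
    ((continuous_pow 2).tendsto M).mono_left nhdsWithin_le_nhds
  refine ge_of_tendsto hc ?_
  filter_upwards [self_mem_nhdsWithin] with M' hM'
  exact h M' hM' U hU V hV a b ha hb hsa hsb

/-- The interpolation norm satisfies the trace bound, by the three lines theorem applied to
`α^((1-z)/2) f(z) β^(z/2)`. -/
theorem dominated_interpolation {θ : ℝ} (hθ0 : 0 ≤ θ) (hθ1 : θ ≤ 1)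
    (x : Matrix (Fin n) (Fin n) Ell2) : Dominated θ x (interpolation θ row column n x) := by
  refine Dominated.of_forall_gt fun M hM => ?_
  obtain ⟨f, hf, h0, h1, rfl⟩ := exists_isStripFunction hM
  have hM0 : 0 ≤ M := (interpolation_nonneg _ _ _ _).trans hM.le
  have := hf.dominated hM0 (fun t => ((row_le_iff hM0).1 (h0 t)).dominated)
    (fun t => ((column_le_iff hM0).1 (h1 t)).dominated_transpose) hθ0 hθ1
  simpa using this

end Dominated

/-! ### Critical points of the trace functional -/

/-- The equality case of the weighted arithmetic–geometric mean inequality. -/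
theorem eq_of_weighted_mean_eq {θ a s : ℝ} (h0 : 0 < θ) (h1 : θ < 1) (ha : 0 ≤ a) (hs : 0 ≤ s)
    (h : a ^ (1 - θ) * s ^ θ = (1 - θ) * a + θ * s) : a = s := by
  have := (Real.geom_mean_eq_arith_mean_weighted_iff_of_pos' Finset.univ ![1 - θ, θ] ![a, s]
    (by simp [Fin.forall_fin_two, h0, h1]) (by simp [Fin.sum_univ_two])
    (by simp [Fin.forall_fin_two, ha, hs])).1
      (by simpa [Fin.prod_univ_two, Fin.sum_univ_two] using h)
  have e0 := this 0 (Finset.mem_univ _)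
  have e1 := this 1 (Finset.mem_univ _)
  simp only [Matrix.cons_val_zero, Matrix.cons_val_one] at e0 e1
  exact e0.trans e1.symm

/-- If the density matrix `diag(a)` maximizes `Tr (α^(1-θ) T)` over all density matrices `α`,
then `T = N diag(a)^θ`, where `N` is the maximum. The maximum is attained at a multiple of
`T^(1/θ)`, and the equality case of Young's inequality, applied to the entries of `a` and the
eigenvalues of `T`, shows that there is no other maximizer. -/
theorem eq_diagonal_of_isMax {n : ℕ} {T : Matrix (Fin n) (Fin n) ℂ} (hT : T.IsHermitian)
    (hpos : ∀ W ∈ Matrix.unitaryGroup (Fin n) ℂ, ∀ j, 0 ≤ ((W * T * star W) j j).re)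
    {θ : ℝ} (h0 : 0 < θ) (h1 : θ < 1) {a : Fin n → ℝ} (ha : ∀ j, 0 ≤ a j) (hsa : ∑ j, a j ≤ 1)
    {N : ℝ} (hN : 0 < N) (hval : ∑ j, a j ^ (1 - θ) * (T j j).re = N)
    (hmax : ∀ W ∈ Matrix.unitaryGroup (Fin n) ℂ, ∀ a' : Fin n → ℝ, (∀ j, 0 ≤ a' j) →
      ∑ j, a' j ≤ 1 → ∑ j, a' j ^ (1 - θ) * ((W * T * star W) j j).re ≤ N) :
    T = Matrix.diagonal fun j => ((N * a j ^ θ : ℝ) : ℂ) := by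
  set E : Matrix (Fin n) (Fin n) ℂ := hT.eigenvectorUnitary.1
  have hE : E ∈ Matrix.unitaryGroup (Fin n) ℂ := hT.eigenvectorUnitary.2
  set t : Fin n → ℝ := hT.eigenvalues
  have hTE : T = E * Matrix.diagonal (fun l => (t l : ℂ)) * star E := by
    have := hT.spectral_theorem
    rw [Unitary.conjStarAlgAut_apply] at this
    exact this
  have hEE : star E * E = 1 := Matrix.mem_unitaryGroup_iff'.1 hE
  have hEE' : E * star E = 1 := Matrix.mem_unitaryGroup_iff.1 hE
  have hsE : star E ∈ Matrix.unitaryGroup (Fin n) ℂ := by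
    rw [Matrix.mem_unitaryGroup_iff, star_star, hEE]
  have hdiag : star E * T * star (star E) = Matrix.diagonal fun l => (t l : ℂ) := by
    rw [star_star, hTE]
    calc star E * (E * Matrix.diagonal (fun l => (t l : ℂ)) * star E) * E
        = (star E * E) * Matrix.diagonal (fun l => (t l : ℂ)) * (star E * E) := by
          simp only [Matrix.mul_assoc]
      _ = _ := by rw [hEE, one_mul, mul_one]
  have ht : ∀ l, 0 ≤ t l := by
    intro l
    have := hpos _ hsE l
    rw [hdiag] at this
    simpa using this
  set s : Fin n → ℝ := fun l => (t l / N) ^ (1 / θ)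
  have hs : ∀ l, 0 ≤ s l := fun l => Real.rpow_nonneg (div_nonneg (ht l) hN.le) _
  have hsθ : ∀ l, s l ^ θ = t l / N := by
    intro l
    rw [← Real.rpow_mul (div_nonneg (ht l) hN.le), one_div_mul_cancel h0.ne', Real.rpow_one]
  -- testing against the multiple `s / ∑ s` of `T^(1/θ)`
  have hS : ∑ l, s l ≤ 1 := by
    by_contra! hlt
    set S := ∑ l, s l
    have hS0 : 0 < S := by linarith
    have := hmax _ hsE (fun l => s l / S) (fun l => div_nonneg (hs l) hS0.le)
      (by rw [← Finset.sum_div, div_self hS0.ne'])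
    rw [hdiag] at this
    have e : ∀ l, (s l / S) ^ (1 - θ) * ((Matrix.diagonal fun l => (t l : ℂ)) l l).re
        = s l * (N / S ^ (1 - θ)) := by
      intro l
      have e2 : t l = N * s l ^ θ := by rw [hsθ]; field_simp
      have e3 : s l ^ (1 - θ) * s l ^ θ = s l := by
        rw [← Real.rpow_add_of_nonneg (hs l) (by linarith) h0.le]; simp
      rw [Matrix.diagonal_apply_eq, Complex.ofReal_re, Real.div_rpow (hs l) hS0.le, e2]
      calc _ = (s l ^ (1 - θ) * s l ^ θ) * (N / S ^ (1 - θ)) := by ring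
        _ = _ := by rw [e3]
    simp only [e] at this
    rw [← Finset.sum_mul] at this
    have hlt2 : S ^ (1 - θ) < S := by
      conv_rhs => rw [← Real.rpow_one S]
      exact Real.rpow_lt_rpow_of_exponent_lt hlt (by linarith)
    have hp : 0 < S ^ (1 - θ) := by positivity
    rw [mul_div_assoc', div_le_iff₀ hp] at this
    nlinarith
  set p : Fin n → Fin n → ℝ := fun j l => ‖E j l‖ ^ 2
  have hp : ∀ j l, ((p j l : ℝ) : ℂ) = E j l * (starRingEnd ℂ) (E j l) := by
    intro j l
    rw [Complex.mul_conj, Complex.normSq_eq_norm_sq]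
  have hpj : ∀ j, ∑ l, p j l = 1 := by
    intro j
    have := congrFun (congrFun hEE' j) j
    rw [Matrix.mul_apply, Matrix.one_apply_eq] at this
    have h : ((∑ l, p j l : ℝ) : ℂ) = 1 := by
      rw [← this, Complex.ofReal_sum]
      exact Finset.sum_congr rfl fun l _ => hp j l
    exact_mod_cast h
  have hpl : ∀ l, ∑ j, p j l = 1 := by
    intro l
    have := congrFun (congrFun hEE l) l
    rw [Matrix.mul_apply, Matrix.one_apply_eq] at this
    have h : ((∑ j, p j l : ℝ) : ℂ) = 1 := by
      rw [← this, Complex.ofReal_sum]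
      exact Finset.sum_congr rfl fun j _ => by rw [hp, mul_comm]; rfl
    exact_mod_cast h
  have hentry : ∀ j k, T j k = ∑ l, E j l * t l * (starRingEnd ℂ) (E k l) := by
    intro j k
    rw [hTE, Matrix.mul_apply]
    exact Finset.sum_congr rfl fun l _ => by rw [Matrix.mul_diagonal]; rfl
  have hTjj : ∀ j, (T j j).re = ∑ l, p j l * t l := by
    intro j
    have : T j j = ((∑ l, p j l * t l : ℝ) : ℂ) := by
      rw [hentry, Complex.ofReal_sum]
      refine Finset.sum_congr rfl fun l _ => ?_
      rw [Complex.ofReal_mul, hp]; ring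
    rw [this, Complex.ofReal_re]
  have hyoung : ∀ j l, a j ^ (1 - θ) * s l ^ θ ≤ (1 - θ) * a j + θ * s l := fun j l =>
    Real.geom_mean_le_arith_mean2_weighted (by linarith) h0.le (ha j) (hs l) (by ring)
  have hterm : ∀ j l, 0 ≤ p j l * ((1 - θ) * a j + θ * s l - a j ^ (1 - θ) * s l ^ θ) :=
    fun j l => mul_nonneg (sq_nonneg _) (sub_nonneg.2 (hyoung j l))
  have hsum : ∑ j, ∑ l, p j l * ((1 - θ) * a j + θ * s l - a j ^ (1 - θ) * s l ^ θ) ≤ 0 := by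
    have e1 : ∑ j, ∑ l, p j l * ((1 - θ) * a j) = (1 - θ) * ∑ j, a j := by
      rw [Finset.mul_sum]
      exact Finset.sum_congr rfl fun j _ => by rw [← Finset.sum_mul, hpj, one_mul]
    have e2 : ∑ j, ∑ l, p j l * (θ * s l) = θ * ∑ l, s l := by
      rw [Finset.sum_comm, Finset.mul_sum]
      exact Finset.sum_congr rfl fun l _ => by rw [← Finset.sum_mul, hpl, one_mul]
    have e3 : ∑ j, ∑ l, p j l * (a j ^ (1 - θ) * s l ^ θ) = 1 := by
      calc ∑ j, ∑ l, p j l * (a j ^ (1 - θ) * s l ^ θ)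
          = N⁻¹ * ∑ j, a j ^ (1 - θ) * (T j j).re := by
            simp only [hTjj, hsθ, Finset.mul_sum]
            exact Finset.sum_congr rfl fun j _ => Finset.sum_congr rfl fun l _ => by
              rw [div_eq_mul_inv]; ring
        _ = 1 := by rw [hval, inv_mul_cancel₀ hN.ne']
    simp only [mul_sub, mul_add, Finset.sum_sub_distrib, Finset.sum_add_distrib, e1, e2, e3]
    nlinarith
  have hzero : ∀ j l, p j l ≠ 0 → a j = s l := by
    intro j l hne
    have h2 := (Finset.sum_eq_zero_iff_of_nonneg fun j _ =>
      Finset.sum_nonneg fun l _ => hterm j l).1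
      (le_antisymm hsum (Finset.sum_nonneg fun j _ => Finset.sum_nonneg fun l _ => hterm j l))
      j (Finset.mem_univ j)
    have h3 := (Finset.sum_eq_zero_iff_of_nonneg fun l _ => hterm j l).1 h2 l (Finset.mem_univ l)
    have h4 := (mul_eq_zero.1 h3).resolve_left hne
    exact eq_of_weighted_mean_eq h0 h1 (ha j) (hs l) (by linarith)
  ext j k
  have hcoef : ∀ l, E j l * t l * (starRingEnd ℂ) (E k l)
      = ((N * a j ^ θ : ℝ) : ℂ) * (E j l * star E l k) := by
    intro l
    by_cases hne : p j l = 0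
    · have : E j l = 0 := by simpa [p] using hne
      simp [this]
    · have : t l = N * a j ^ θ := by
        rw [hzero j l hne, hsθ]; field_simp
      rw [this]
      change _ = _ * (E j l * (starRingEnd ℂ) (E k l))
      ring
  rw [hentry]
  simp only [hcoef]
  rw [← Finset.mul_sum, ← Matrix.mul_apply, hEE', Matrix.one_apply, Matrix.diagonal_apply]
  split_ifs <;> simp

section Maximizer

variable {n : ℕ} {E : Type*} [NormedAddCommGroup E] [InnerProductSpace ℂ E]

/-- The matrix `∑ᵢ xᵢ diag(β) xᵢ* + c`, where `xᵢ` are the coordinates of `x`. -/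
def gram (β : Fin n → ℝ) (c : ℝ) (x : Matrix (Fin n) (Fin n) E) : Matrix (Fin n) (Fin n) ℂ :=
  Matrix.of fun j s => ∑ l, (β l : ℂ) * inner ℂ (x s l) (x j l) + if j = s then (c : ℂ) else 0

theorem gram_isHermitian (β : Fin n → ℝ) (c : ℝ) (x : Matrix (Fin n) (Fin n) E) :
    (gram β c x).IsHermitian := by
  ext j s
  simp only [gram, Matrix.conjTranspose_apply, Matrix.of_apply, star_add, star_sum,
    RCLike.star_def, map_mul, Complex.conj_ofReal, inner_conj_symm]
  congr 1
  by_cases h : j = s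
  · subst h; simp
  · simp [h, Ne.symm h]

/-- The quadratic form of the Gram matrix. -/
theorem gram_quadratic (β : Fin n → ℝ) (c : ℝ) (x : Matrix (Fin n) (Fin n) E) (ξ : Fin n → ℂ) :
    ∑ j, ∑ s, ξ j * gram β c x j s * (starRingEnd ℂ) (ξ s)
      = ((∑ l, β l * ‖∑ j, ξ j • x j l‖ ^ 2 + c * ∑ j, ‖ξ j‖ ^ 2 : ℝ) : ℂ) := by
  have h2 : ∀ v : E, ((‖v‖ : ℂ)) ^ 2 = inner ℂ v v := by
    intro v; rw [inner_self_eq_norm_sq_to_K]; simp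
  have h3 : ∀ v : ℂ, ((‖v‖ : ℂ)) ^ 2 = v * (starRingEnd ℂ) v := by
    intro v; rw [Complex.mul_conj, Complex.normSq_eq_norm_sq]; push_cast; rfl
  push_cast
  simp only [h2, h3, sum_inner, inner_sum, inner_smul_left, inner_smul_right, gram,
    Matrix.of_apply, mul_add, add_mul, Finset.sum_add_distrib]
  congr 1
  · simp only [Finset.mul_sum, Finset.sum_mul]
    rw [Finset.sum_congr rfl fun j _ => Finset.sum_comm, Finset.sum_comm]
    refine Finset.sum_congr rfl fun l _ => Finset.sum_congr rfl fun j _ =>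
      Finset.sum_congr rfl fun s _ => ?_
    ring
  · rw [Finset.mul_sum]
    refine Finset.sum_congr rfl fun j _ => ?_
    simp only [mul_ite, ite_mul, mul_zero, zero_mul, Finset.sum_ite_eq, Finset.mem_univ, if_true]
    ring

theorem gram_conj (β : Fin n → ℝ) (c : ℝ) (x : Matrix (Fin n) (Fin n) E)
    {W : Matrix (Fin n) (Fin n) ℂ} (hW : W ∈ Matrix.unitaryGroup (Fin n) ℂ) (j : Fin n) :
    ((W * gram β c x * star W) j j).re = ∑ l, β l * ‖∑ s, W j s • x s l‖ ^ 2 + c := by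
  have h : (W * gram β c x * star W) j j
      = ∑ i, ∑ s, W j i * gram β c x i s * (starRingEnd ℂ) (W j s) := by
    rw [Matrix.mul_apply, Finset.sum_comm]
    refine Finset.sum_congr rfl fun s _ => ?_
    rw [Matrix.mul_apply, Finset.sum_mul]
    rfl
  rw [h, gram_quadratic, Complex.ofReal_re, sum_norm_sq_row_eq_one hW, mul_one]

theorem sandwich_left (W : Matrix (Fin n) (Fin n) ℂ) (x : Matrix (Fin n) (Fin n) E)
    (j l : Fin n) : sandwich W 1 x j l = ∑ s, W j s • x s l := by
  simp [sandwich_apply, Matrix.one_apply, ite_smul]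

/-- The Euler–Lagrange equation, on one side, at a maximum of the trace functional. -/
theorem sum_eq_of_isMax {x : Matrix (Fin n) (Fin n) E} {θ : ℝ} (h0 : 0 < θ) (h1 : θ < 1)
    {a b : Fin n → ℝ} (ha : ∀ j, 0 ≤ a j) (hb : ∀ l, 0 ≤ b l) (hsa : ∑ j, a j ≤ 1)
    {c N : ℝ} (hc : 0 ≤ c) (hN : 0 < N)
    (hval : ∑ j, ∑ l, a j ^ (1 - θ) * b l ^ θ * (‖x j l‖ ^ 2 + c) = N)
    (hmax : ∀ W ∈ Matrix.unitaryGroup (Fin n) ℂ, ∀ a' : Fin n → ℝ, (∀ j, 0 ≤ a' j) →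
      ∑ j, a' j ≤ 1 →
      ∑ j, ∑ l, a' j ^ (1 - θ) * b l ^ θ * (‖sandwich W 1 x j l‖ ^ 2 + c) ≤ N)
    (ξ : Fin n → ℂ) :
    ∑ l, b l ^ θ * (‖∑ j, ξ j • x j l‖ ^ 2 + c * ∑ j, ‖ξ j‖ ^ 2)
      = N * ∑ j, a j ^ θ * ‖ξ j‖ ^ 2 := by
  set β : Fin n → ℝ := fun l => b l ^ θ
  have hβ : ∀ l, 0 ≤ β l := fun l => Real.rpow_nonneg (hb l) _
  set T := gram β (∑ l, β l * c) x
  have hconj : ∀ W ∈ Matrix.unitaryGroup (Fin n) ℂ, ∀ j,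
      ((W * T * star W) j j).re = ∑ l, β l * (‖sandwich W 1 x j l‖ ^ 2 + c) := by
    intro W hW j
    rw [gram_conj _ _ _ hW]
    simp only [sandwich_left, mul_add, Finset.sum_add_distrib]
  have hfun : ∀ W ∈ Matrix.unitaryGroup (Fin n) ℂ, ∀ a' : Fin n → ℝ,
      ∑ j, a' j ^ (1 - θ) * ((W * T * star W) j j).re
        = ∑ j, ∑ l, a' j ^ (1 - θ) * b l ^ θ * (‖sandwich W 1 x j l‖ ^ 2 + c) := by
    intro W hW a'
    refine Finset.sum_congr rfl fun j _ => ?_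
    rw [hconj W hW, Finset.mul_sum]
    exact Finset.sum_congr rfl fun l _ => by simp only [β]; ring
  have hT := eq_diagonal_of_isMax (gram_isHermitian β (∑ l, β l * c) x)
    (fun W hW j => by
      rw [hconj W hW]
      exact Finset.sum_nonneg fun l _ => mul_nonneg (hβ l) (by positivity))
    h0 h1 ha hsa hN
    (by
      have := hfun 1 (one_mem _) a
      rw [sandwich_one, hval] at this
      simpa using this)
    (fun W hW a' ha' hs' => by rw [hfun W hW]; exact hmax W hW a' ha' hs')
  have hq := gram_quadratic β (∑ l, β l * c) x ξ
  rw [hT] at hq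
  have hq2 : ∑ j, ∑ s, ξ j * (Matrix.diagonal fun j => ((N * a j ^ θ : ℝ) : ℂ)) j s
      * (starRingEnd ℂ) (ξ s) = ((N * ∑ j, a j ^ θ * ‖ξ j‖ ^ 2 : ℝ) : ℂ) := by
    rw [Finset.mul_sum, Complex.ofReal_sum]
    refine Finset.sum_congr rfl fun j _ => ?_
    rw [Finset.sum_eq_single j]
    · rw [Matrix.diagonal_apply_eq]
      have : ((‖ξ j‖ ^ 2 : ℝ) : ℂ) = ξ j * (starRingEnd ℂ) (ξ j) := by
        rw [Complex.mul_conj, Complex.normSq_eq_norm_sq]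
      rw [← mul_assoc, Complex.ofReal_mul _ (‖ξ j‖ ^ 2), this]; ring
    · intro s _ hs
      rw [Matrix.diagonal_apply_ne _ hs.symm]; simp
    · simp
  rw [hq2] at hq
  have hq3 := (Complex.ofReal_injective hq).symm
  rw [← hq3]
  simp only [β, mul_add, Finset.sum_add_distrib, Finset.sum_mul]
  congr 1
  exact Finset.sum_congr rfl fun l _ => by ring

theorem isCompact_unitaryGroup :
    IsCompact {U : Matrix (Fin n) (Fin n) ℂ | U ∈ Matrix.unitaryGroup (Fin n) ℂ} := by
  have hK : IsCompact (Set.univ.pi fun _ : Fin n => Set.univ.pi fun _ : Fin n =>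
      Metric.closedBall (0 : ℂ) 1) :=
    isCompact_univ_pi fun _ => isCompact_univ_pi fun _ => isCompact_closedBall _ _
  refine hK.of_isClosed_subset ?_ ?_
  · simp only [Matrix.mem_unitaryGroup_iff]
    exact isClosed_eq (by fun_prop) continuous_const
  · intro U hU
    simp only [Set.mem_pi, Set.mem_univ, true_imp_iff, mem_closedBall_zero_iff]
    exact fun i j => entry_norm_bound_of_unitary hU i j

theorem isCompact_subdensities : IsCompact {a : Fin n → ℝ | (∀ j, 0 ≤ a j) ∧ ∑ j, a j ≤ 1} := by
  have hK : IsCompact (Set.univ.pi fun _ : Fin n => Set.Icc (0 : ℝ) 1) :=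
    isCompact_univ_pi fun _ => isCompact_Icc
  refine hK.of_isClosed_subset ?_ ?_
  · have : {a : Fin n → ℝ | (∀ j, 0 ≤ a j) ∧ ∑ j, a j ≤ 1}
        = (⋂ j, {a : Fin n → ℝ | 0 ≤ a j}) ∩ {a : Fin n → ℝ | ∑ j, a j ≤ 1} := by
      ext a; simp
    rw [this]
    exact (isClosed_iInter fun j => isClosed_le continuous_const (continuous_apply j)).inter
      (isClosed_le (by fun_prop) continuous_const)
  · intro a ha j _
    exact ⟨ha.1 j, (Finset.single_le_sum (fun i _ => ha.1 i) (Finset.mem_univ j)).trans ha.2⟩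

/-- Weights `a`, `b` for which `x` satisfies, up to the factor `N`, the inequalities
`∑ᵢ xᵢ b^θ xᵢ* ≤ N a^θ` and `∑ᵢ xᵢ* a^(1-θ) xᵢ ≤ N b^(1-θ)`. -/
structure IsBalanced (θ : ℝ) (x : Matrix (Fin n) (Fin n) E) (a b : Fin n → ℝ) (N : ℝ) :
    Prop where
  pos_left : ∀ j, 0 < a j
  pos_right : ∀ l, 0 < b l
  nonneg : 0 ≤ N
  row_le : ∀ ξ : Fin n → ℂ,
    ∑ l, b l ^ θ * ‖∑ j, ξ j • x j l‖ ^ 2 ≤ N * ∑ j, a j ^ θ * ‖ξ j‖ ^ 2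
  column_le : ∀ ξ : Fin n → ℂ,
    ∑ j, a j ^ (1 - θ) * ‖∑ l, ξ l • x j l‖ ^ 2 ≤ N * ∑ l, b l ^ (1 - θ) * ‖ξ l‖ ^ 2

/-- Every matrix is balanced by suitable densities. These maximize the trace functional of
`Dominated`; the term `c > 0` forces the maximizing densities to be invertible. -/
theorem exists_isBalanced {θ : ℝ} (h0 : 0 < θ) (h1 : θ < 1) (x : Matrix (Fin n) (Fin n) E)
    {c : ℝ} (hc : 0 < c) :
    ∃ U ∈ Matrix.unitaryGroup (Fin n) ℂ, ∃ V ∈ Matrix.unitaryGroup (Fin n) ℂ,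
      ∃ (a b : Fin n → ℝ) (N : ℝ), IsBalanced θ (sandwich U V x) a b N ∧
        ∑ j, a j ≤ 1 ∧ ∑ l, b l ≤ 1 ∧
        ∑ j, ∑ l, a j ^ (1 - θ) * b l ^ θ * (‖sandwich U V x j l‖ ^ 2 + c) = N := by
  rcases Nat.eq_zero_or_pos n with rfl | hn
  · exact ⟨1, one_mem _, 1, one_mem _, 0, 0, 0,
      ⟨fun j => j.elim0, fun j => j.elim0, le_rfl, by simp, by simp⟩, by simp, by simp, by simp⟩
  set D := {a : Fin n → ℝ | (∀ j, 0 ≤ a j) ∧ ∑ j, a j ≤ 1}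
  set G := {U : Matrix (Fin n) (Fin n) ℂ | U ∈ Matrix.unitaryGroup (Fin n) ℂ}
  set Φ : (Matrix (Fin n) (Fin n) ℂ × Matrix (Fin n) (Fin n) ℂ) × (Fin n → ℝ) × (Fin n → ℝ) → ℝ :=
    fun p => ∑ j, ∑ l, p.2.1 j ^ (1 - θ) * p.2.2 l ^ θ * (‖sandwich p.1.1 p.1.2 x j l‖ ^ 2 + c)
  have hΦ : Continuous Φ := by
    refine continuous_finsetSum _ fun j _ => continuous_finsetSum _ fun l _ => ?_
    refine Continuous.mul (Continuous.mul ?_ ?_)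
      (Continuous.add (Continuous.pow (Continuous.norm ?_) 2) continuous_const)
    · exact (Real.continuous_rpow_const (by linarith)).comp (by fun_prop)
    · exact (Real.continuous_rpow_const h0.le).comp (by fun_prop)
    · simp only [sandwich_apply]
      fun_prop
  have hcomp : IsCompact ((G ×ˢ G) ×ˢ (D ×ˢ D)) :=
    (isCompact_unitaryGroup.prod isCompact_unitaryGroup).prod
      (isCompact_subdensities.prod isCompact_subdensities)
  have hu : (fun _ => (n : ℝ)⁻¹ : Fin n → ℝ) ∈ D := by
    refine ⟨fun _ => by positivity, ?_⟩
    have : (n : ℝ) ≠ 0 := by positivity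
    simp [this]
  have h1G : (1 : Matrix (Fin n) (Fin n) ℂ) ∈ G := one_mem (Matrix.unitaryGroup (Fin n) ℂ)
  have hmem : ((1, 1), ((fun _ => (n : ℝ)⁻¹), (fun _ => (n : ℝ)⁻¹))) ∈ ((G ×ˢ G) ×ˢ (D ×ˢ D)) :=
    ⟨⟨h1G, h1G⟩, hu, hu⟩
  obtain ⟨⟨⟨U, V⟩, a, b⟩, ⟨⟨hU, hV⟩, ha, hb⟩, hmax⟩ :=
    hcomp.exists_isMaxOn ⟨_, hmem⟩ hΦ.continuousOn
  set y := sandwich U V x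
  set N := ∑ j, ∑ l, a j ^ (1 - θ) * b l ^ θ * (‖y j l‖ ^ 2 + c)
  have hM : ∀ U' ∈ G, ∀ V' ∈ G, ∀ a' ∈ D, ∀ b' ∈ D,
      ∑ j, ∑ l, a' j ^ (1 - θ) * b' l ^ θ * (‖sandwich U' V' x j l‖ ^ 2 + c) ≤ N :=
    fun U' hU' V' hV' a' ha' b' hb' => hmax (a := ((U', V'), (a', b'))) ⟨⟨hU', hV'⟩, ha', hb'⟩
  have hN : 0 < N := by
    have hn' : (0 : ℝ) < n := by exact_mod_cast hn
    have : Nonempty (Fin n) := ⟨⟨0, hn⟩⟩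
    refine lt_of_lt_of_le ?_ (hM _ h1G _ h1G _ hu _ hu)
    exact Finset.sum_pos (fun j _ => Finset.sum_pos (fun l _ => by positivity)
      Finset.univ_nonempty) Finset.univ_nonempty
  have hrow := sum_eq_of_isMax h0 h1 ha.1 hb.1 ha.2 hc.le hN (x := y) rfl
    (fun W hW a' ha' hs' => by
      simp only [y, sandwich_sandwich, mul_one]
      exact hM _ (mul_mem hW hU) _ hV a' ⟨ha', hs'⟩ b hb)
  have hcol := sum_eq_of_isMax (θ := 1 - θ) (by linarith) (by linarith) hb.1 ha.1 hb.2 hc.le hN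
    (x := y.transpose)
    (by
      rw [Finset.sum_comm, sub_sub_cancel]
      exact Finset.sum_congr rfl fun j _ => Finset.sum_congr rfl fun l _ => by
        rw [Matrix.transpose_apply]; ring)
    (fun W hW b' hb' hs' => by
      refine le_trans (le_of_eq ?_) (hM _ hU _ (mul_mem hV (transpose_mem_unitaryGroup hW)) a ha
        b' ⟨hb', hs'⟩)
      rw [Finset.sum_comm, sub_sub_cancel]
      refine Finset.sum_congr rfl fun j _ => Finset.sum_congr rfl fun l _ => ?_
      have e := congrFun (congrFun (sandwich_transpose 1 W.transpose y) l) j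
      rw [Matrix.transpose_apply, Matrix.transpose_transpose, Matrix.transpose_one] at e
      rw [← e, sandwich_sandwich, one_mul]
      ring)
  have hsq : ∀ i k : Fin n, ‖(Pi.single i (1 : ℂ) : Fin n → ℂ) k‖ ^ 2 = if k = i then 1 else 0 := by
    intro i k
    by_cases hk : k = i
    · subst hk; simp
    · simp [hk]
  have hposa : ∀ j, 0 < a j := by
    intro j
    by_contra hj
    have hj0 : a j = 0 := le_antisymm (not_lt.1 hj) (ha.1 j)
    have h := hrow (Pi.single j 1)
    simp only [hsq, mul_ite, mul_one, mul_zero, Finset.sum_ite_eq', Finset.mem_univ, if_true, hj0,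
      Real.zero_rpow h0.ne'] at h
    have hbl : ∀ l, b l ^ θ = 0 := by
      intro l
      have hnn : ∀ l ∈ Finset.univ, 0 ≤ b l ^ θ *
          (‖∑ k, (Pi.single j (1 : ℂ) : Fin n → ℂ) k • y k l‖ ^ 2 + c) := fun l _ =>
        mul_nonneg (Real.rpow_nonneg (hb.1 l) _) (by positivity)
      have := (Finset.sum_eq_zero_iff_of_nonneg hnn).1 h l (Finset.mem_univ l)
      exact (mul_eq_zero.1 this).resolve_right (by positivity)
    exact hN.ne' (Finset.sum_eq_zero fun j _ => Finset.sum_eq_zero fun l _ => by rw [hbl l]; ring)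
  have hposb : ∀ l, 0 < b l := by
    intro l
    by_contra hl
    have hl0 : b l = 0 := le_antisymm (not_lt.1 hl) (hb.1 l)
    have h := hcol (Pi.single l 1)
    simp only [hsq, mul_ite, mul_one, mul_zero, Finset.sum_ite_eq', Finset.mem_univ, if_true, hl0,
      Real.zero_rpow (sub_pos.2 h1).ne'] at h
    have haj : ∀ j, a j ^ (1 - θ) = 0 := by
      intro j
      have hnn : ∀ j ∈ Finset.univ, 0 ≤ a j ^ (1 - θ) *
          (‖∑ k, (Pi.single l (1 : ℂ) : Fin n → ℂ) k • y.transpose k j‖ ^ 2 + c) := fun j _ =>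
        mul_nonneg (Real.rpow_nonneg (ha.1 j) _) (by positivity)
      have := (Finset.sum_eq_zero_iff_of_nonneg hnn).1 h j (Finset.mem_univ j)
      exact (mul_eq_zero.1 this).resolve_right (by positivity)
    exact hN.ne' (Finset.sum_eq_zero fun j _ => Finset.sum_eq_zero fun l _ => by rw [haj j]; ring)
  refine ⟨U, hU, V, hV, a, b, N, ⟨hposa, hposb, hN.le, fun ξ => ?_, fun ξ => ?_⟩, ha.2, hb.2, rfl⟩
  · rw [← hrow ξ]
    refine Finset.sum_le_sum fun l _ => mul_le_mul_of_nonneg_left ?_ (Real.rpow_nonneg (hb.1 l) _)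
    have : 0 ≤ c * ∑ j, ‖ξ j‖ ^ 2 := by positivity
    linarith
  · rw [← hcol ξ]
    refine Finset.sum_le_sum fun j _ => mul_le_mul_of_nonneg_left ?_ (Real.rpow_nonneg (ha.1 j) _)
    have : 0 ≤ c * ∑ j, ‖ξ j‖ ^ 2 := by positivity
    simp only [Matrix.transpose_apply]
    linarith

end Maximizer

/-! ### The trace formula for the interpolation norms: upper bound -/

section Balanced

variable {n : ℕ} {E : Type*} [NormedAddCommGroup E] [InnerProductSpace ℂ E]
  {θ : ℝ} {x : Matrix (Fin n) (Fin n) E} {a b : Fin n → ℝ} {N : ℝ}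

theorem IsBalanced.transpose (h : IsBalanced θ x a b N) :
    IsBalanced (1 - θ) x.transpose b a N :=
  ⟨h.pos_right, h.pos_left, h.nonneg, h.column_le, by simpa using h.row_le⟩

theorem IsBalanced.smul (h : IsBalanced θ x a b N) (r : ℝ) :
    IsBalanced θ ((r : ℂ) • x) a b (r ^ 2 * N) := by
  have key : ∀ {ι : Type} [Fintype ι] (ξ : ι → ℂ) (v : ι → E),
      ‖∑ j, ξ j • (r : ℂ) • v j‖ ^ 2 = r ^ 2 * ‖∑ j, ξ j • v j‖ ^ 2 := by
    intro ι _ ξ v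
    simp only [smul_comm _ (r : ℂ)]
    rw [← Finset.smul_sum, norm_smul, mul_pow, Complex.norm_real, Real.norm_eq_abs, sq_abs]
  refine ⟨h.pos_left, h.pos_right, mul_nonneg (sq_nonneg r) h.nonneg, fun ξ => ?_, fun ξ => ?_⟩
  · simp only [Matrix.smul_apply, key, mul_left_comm _ (r ^ 2)]
    rw [← Finset.mul_sum, mul_assoc]
    exact mul_le_mul_of_nonneg_left (h.row_le ξ) (sq_nonneg r)
  · simp only [Matrix.smul_apply, key, mul_left_comm _ (r ^ 2)]
    rw [← Finset.mul_sum, mul_assoc]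
    exact mul_le_mul_of_nonneg_left (h.column_le ξ) (sq_nonneg r)

/-- The analytic function `z ↦ a^((z-θ)/2) x b^((θ-z)/2)`, whose value at `θ` is `x`. -/
def balancedFun (θ : ℝ) (a b : Fin n → ℝ) (x : Matrix (Fin n) (Fin n) E) (z : ℂ) :
    Matrix (Fin n) (Fin n) E :=
  Matrix.of fun j l =>
    Complex.exp (((Real.log (b l) - Real.log (a j)) / 2 * θ : ℝ) +
      ((Real.log (a j) - Real.log (b l)) / 2 : ℝ) * z) • x j l

theorem isStripFunction_balancedFun (θ : ℝ) (a b : Fin n → ℝ) (x : Matrix (Fin n) (Fin n) E) :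
    IsStripFunction (balancedFun θ a b x) :=
  (isStripFunction_const x).exp_smul _ _

theorem balancedFun_self (θ : ℝ) (a b : Fin n → ℝ) (x : Matrix (Fin n) (Fin n) E) :
    balancedFun θ a b x θ = x := by
  ext j l
  rw [balancedFun, Matrix.of_apply]
  have : ((((Real.log (b l) - Real.log (a j)) / 2 * θ : ℝ) : ℂ) +
      ((Real.log (a j) - Real.log (b l)) / 2 : ℝ) * (θ : ℂ)) = 0 := by
    push_cast; ring
  rw [this, Complex.exp_zero, one_smul]

theorem balancedFun_transpose (θ : ℝ) (a b : Fin n → ℝ) (x : Matrix (Fin n) (Fin n) E) (z : ℂ) :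
    (balancedFun θ a b x z).transpose = balancedFun (1 - θ) b a x.transpose (1 - z) := by
  ext j l
  simp only [balancedFun, Matrix.transpose_apply, Matrix.of_apply]
  congr 2
  push_cast; ring

/-- On the left line, multiplication by the weights turns `x b^θ x* ≤ N a^θ` into a bound for the
row norm; the imaginary powers are unitary diagonal matrices. -/
theorem IsBalanced.rowLE_left (h : IsBalanced θ x a b N) (t : ℝ) :
    RowLE (balancedFun θ a b x (t * Complex.I)) √N := by
  intro ξ
  set w : Fin n → ℂ := fun j =>
    Complex.exp ((-(Real.log (a j) / 2 * θ) : ℝ) + (Real.log (a j) / 2 : ℝ) * (t * Complex.I))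
  set v : Fin n → ℂ := fun l =>
    Complex.exp ((Real.log (b l) / 2 * θ : ℝ) + (-(Real.log (b l) / 2) : ℝ) * (t * Complex.I))
  have hw : ∀ j, a j ^ θ * ‖w j‖ ^ 2 = 1 := by
    intro j
    rw [norm_cexp_affine_left, Real.rpow_def_of_pos (h.pos_left j), ← Real.exp_nat_mul,
      ← Real.exp_add]
    rw [Real.exp_eq_one_iff]; push_cast; ring
  have hv : ∀ l, ‖v l‖ ^ 2 = b l ^ θ := by
    intro l
    rw [norm_cexp_affine_left, Real.rpow_def_of_pos (h.pos_right l), ← Real.exp_nat_mul]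
    congr 1; push_cast; ring
  have hf : ∀ j l, balancedFun θ a b x (t * Complex.I) j l = v l • w j • x j l := by
    intro j l
    rw [balancedFun, Matrix.of_apply, smul_smul, ← Complex.exp_add]
    congr 2
    push_cast; ring
  have e : ∀ l, ‖∑ j, ξ j • balancedFun θ a b x (t * Complex.I) j l‖ ^ 2
      = b l ^ θ * ‖∑ j, (ξ j * w j) • x j l‖ ^ 2 := by
    intro l
    simp only [hf, smul_comm _ (v l)]
    rw [← Finset.smul_sum, norm_smul, mul_pow, hv]
    simp only [smul_smul]
  simp only [e]
  rw [Real.sq_sqrt h.nonneg]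
  refine (h.row_le _).trans (le_of_eq ?_)
  congr 1
  refine Finset.sum_congr rfl fun j _ => ?_
  rw [norm_mul, mul_pow, mul_left_comm, hw, mul_one]

theorem IsBalanced.rowLE_right (h : IsBalanced θ x a b N) (t : ℝ) :
    RowLE (balancedFun θ a b x (1 + t * Complex.I)).transpose √N := by
  rw [balancedFun_transpose]
  have := h.transpose.rowLE_left (-t)
  rwa [show ((-t : ℝ) : ℂ) * Complex.I = 1 - (1 + t * Complex.I) by push_cast; ring] at this

/-- A matrix satisfying the trace bound with constant `M` is balanced by densities with constant
close to `M²`. -/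
theorem Dominated.exists_isBalanced (h0 : 0 < θ) (h1 : θ < 1) {M : ℝ} (hx : Dominated θ x M)
    {ε : ℝ} (hε : 0 < ε) :
    ∃ U ∈ Matrix.unitaryGroup (Fin n) ℂ, ∃ V ∈ Matrix.unitaryGroup (Fin n) ℂ,
      ∃ (a b : Fin n → ℝ) (N : ℝ), IsBalanced θ (sandwich U V x) a b N ∧
        ∑ j, a j ≤ 1 ∧ ∑ l, b l ≤ 1 ∧ N ≤ M ^ 2 + ε ∧
        N - ε ≤ ∑ j, ∑ l, a j ^ (1 - θ) * b l ^ θ * ‖sandwich U V x j l‖ ^ 2 := by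
  set c : ℝ := ε / ((n : ℝ) ^ 2 + 1)
  have hc : 0 < c := by positivity
  obtain ⟨U, hU, V, hV, a, b, N, hbal, hsa, hsb, hval⟩ := OpSpace.exists_isBalanced h0 h1 x hc
  have hle : ∀ {r : Fin n → ℝ} {s : ℝ}, (∀ j, 0 < r j) → ∑ j, r j ≤ 1 → 0 < s → ∀ j,
      r j ^ s ≤ 1 := fun hr hsr hs j => Real.rpow_le_one (hr j).le
    ((Finset.single_le_sum (fun i _ => (hr i).le) (Finset.mem_univ j)).trans hsr) hs.le
  have hrest : ∑ j, ∑ l, a j ^ (1 - θ) * b l ^ θ * c ≤ ε := by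
    calc ∑ j, ∑ l, a j ^ (1 - θ) * b l ^ θ * c ≤ ∑ j : Fin n, ∑ l : Fin n, 1 * 1 * c := by
          refine Finset.sum_le_sum fun j _ => Finset.sum_le_sum fun l _ => ?_
          have := hle hbal.pos_left hsa (sub_pos.2 h1) j
          have := hle hbal.pos_right hsb h0 l
          have := Real.rpow_pos_of_pos (hbal.pos_right l) θ
          gcongr
      _ = (n : ℝ) ^ 2 * c := by simp; ring
      _ ≤ ε := by
        simp only [c]
        rw [mul_div_assoc', div_le_iff₀ (by positivity)]
        nlinarith
  have hsplit : N = ∑ j, ∑ l, a j ^ (1 - θ) * b l ^ θ * ‖sandwich U V x j l‖ ^ 2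
      + ∑ j, ∑ l, a j ^ (1 - θ) * b l ^ θ * c := by
    rw [← hval]
    simp only [mul_add, Finset.sum_add_distrib]
  have hD := hx U hU V hV a b hbal.pos_left hbal.pos_right hsa hsb
  exact ⟨U, hU, V, hV, a, b, N, hbal, hsa, hsb, by linarith, by linarith⟩

end Balanced

/-- Multiplication by unitary scalar matrices does not affect the bounds of a strip function. -/
theorem interpolation_sandwich_le {n : ℕ} {U V : Matrix (Fin n) (Fin n) ℂ}
    (hU : U ∈ Matrix.unitaryGroup (Fin n) ℂ) (hV : V ∈ Matrix.unitaryGroup (Fin n) ℂ)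
    {θ M : ℝ} {f : ℂ → Matrix (Fin n) (Fin n) Ell2} (hf : IsStripFunction f) (hM : 0 ≤ M)
    (h0 : ∀ t : ℝ, RowLE (f (t * Complex.I)) M)
    (h1 : ∀ t : ℝ, RowLE (f (1 + t * Complex.I)).transpose M) :
    interpolation θ row column n (sandwich U V (f θ)) ≤ M :=
  interpolation_le (hf.sandwich U V) hM
    (fun t => (row_le_iff hM).2 ((h0 t).sandwich hU hV))
    (fun t => (column_le_iff hM).2 ((h1 t).sandwich_transpose hU hV))

theorem star_mem_unitaryGroup {n : ℕ} {U : Matrix (Fin n) (Fin n) ℂ}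
    (hU : U ∈ Matrix.unitaryGroup (Fin n) ℂ) : star U ∈ Matrix.unitaryGroup (Fin n) ℂ := by
  rw [Matrix.mem_unitaryGroup_iff, star_star]
  exact Matrix.mem_unitaryGroup_iff'.1 hU

theorem IsBalanced.interpolation_le {n : ℕ} {x : Matrix (Fin n) (Fin n) Ell2}
    {U V : Matrix (Fin n) (Fin n) ℂ}
    (hU : U ∈ Matrix.unitaryGroup (Fin n) ℂ) (hV : V ∈ Matrix.unitaryGroup (Fin n) ℂ)
    {θ : ℝ} {a b : Fin n → ℝ} {N : ℝ} (h : IsBalanced θ (sandwich U V x) a b N) :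
    interpolation θ row column n x ≤ √N := by
  have := interpolation_sandwich_le (θ := θ) (star_mem_unitaryGroup hU) (star_mem_unitaryGroup hV)
    (isStripFunction_balancedFun θ a b (sandwich U V x)) (Real.sqrt_nonneg N)
    h.rowLE_left h.rowLE_right
  rwa [balancedFun_self, sandwich_star_sandwich hU hV] at this

/-- The trace bound controls the interpolation norm. -/
theorem Dominated.interpolation_le {n : ℕ} {x : Matrix (Fin n) (Fin n) Ell2} {θ M : ℝ}
    (h0 : 0 < θ) (h1 : θ < 1) (hM : 0 ≤ M) (hx : Dominated θ x M) :
    interpolation θ row column n x ≤ M := by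
  refine (sq_le_sq₀ (interpolation_nonneg _ _ _ _) hM).1 (le_of_forall_pos_le_add fun ε hε => ?_)
  obtain ⟨U, hU, V, hV, a, b, N, hbal, -, -, hN, -⟩ := hx.exists_isBalanced h0 h1 hε
  calc _ ≤ √N ^ 2 := pow_le_pow_left₀ (interpolation_nonneg _ _ _ _)
        (hbal.interpolation_le hU hV) 2
    _ = N := Real.sq_sqrt hbal.nonneg
    _ ≤ _ := hN

/-! ### Norming complete contractions into `B(ℓ₂)` -/

theorem norm_sq_blockOperator {H K : Type*} [NormedAddCommGroup H] [InnerProductSpace ℂ H]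
    [NormedAddCommGroup K] [InnerProductSpace ℂ K] {n : ℕ}
    (T : Matrix (Fin n) (Fin n) (H →L[ℂ] K)) (y : PiLp 2 fun _ : Fin n => H) :
    ‖blockOperator T y‖ ^ 2 = ∑ i, ‖∑ j, T i j (y j)‖ ^ 2 := by
  rw [PiLp.norm_sq_eq_of_L2]
  simp only [blockOperator_apply]

/-- The unit vectors of `ℓ₂`. -/
def basisVec (k : ℕ) : Ell2 := lp.single 2 k (1 : ℂ)

theorem orthonormal_basisVec : Orthonormal ℂ basisVec := by
  rw [orthonormal_iff_ite]
  intro i j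
  rw [basisVec, lp.inner_single_left, basisVec]
  by_cases h : i = j
  · subst h; simp
  · simp [h, lp.single_apply]

/-- The map `h ↦ ∑ ⟨y_{pq}, h⟩ e_{pq}` from `ℓ₂` to the matrices of size `n`, seen as operators
on the span of the first `n` unit vectors of `ℓ₂`. -/
def matrixMap {n : ℕ} (y : Matrix (Fin n) (Fin n) Ell2) : Ell2 →ₗ[ℂ] (Ell2 →L[ℂ] Ell2) :=
  ∑ p, ∑ q, (innerSL ℂ (y p q)).toLinearMap.smulRight
    ((innerSL ℂ (basisVec q)).smulRight (basisVec p))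

theorem matrixMap_apply {n : ℕ} (y : Matrix (Fin n) (Fin n) Ell2) (h v : Ell2) :
    matrixMap y h v
      = ∑ p, ∑ q, (inner ℂ (y p q) h * inner ℂ (basisVec q) v) • basisVec p := by
  simp [matrixMap, LinearMap.sum_apply, smul_smul]

theorem inner_blockOperator_matrixMap {m n : ℕ} (y : Matrix (Fin n) (Fin n) Ell2)
    (x : Matrix (Fin m) (Fin m) Ell2) (ζ ξ : PiLp 2 fun _ : Fin m => Ell2) :
    inner ℂ ζ (blockOperator (x.map (matrixMap y)) ξ)
      = ∑ s, ∑ t, ∑ p : Fin n, ∑ q : Fin n, inner ℂ (ζ s) (basisVec p) *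
        inner ℂ (basisVec q) (ξ t) * inner ℂ (y p q) (x s t) := by
  rw [PiLp.inner_apply]
  simp only [blockOperator_apply, Matrix.map_apply, matrixMap_apply, inner_sum, inner_smul_right]
  refine Finset.sum_congr rfl fun s _ => Finset.sum_congr rfl fun t _ =>
    Finset.sum_congr rfl fun p _ => Finset.sum_congr rfl fun q _ => ?_
  ring

theorem operatorMatNorm_matrixMap_le {m n : ℕ} {y : Matrix (Fin n) (Fin n) Ell2}
    {x : Matrix (Fin m) (Fin m) Ell2} {K : ℝ} (hK : 0 ≤ K)
    (h : ∀ ζ ξ : Fin m → Fin n → ℂ,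
      ‖∑ s, ∑ t, ∑ p, ∑ q, ζ s p * ξ t q * inner ℂ (y p q) (x s t)‖ ≤
        K * (√(∑ s, ∑ p, ‖ζ s p‖ ^ 2) * √(∑ t, ∑ q, ‖ξ t q‖ ^ 2))) :
    operatorMatNorm Ell2 Ell2 m (x.map (matrixMap y)) ≤ K := by
  have hon : Orthonormal ℂ fun p : Fin n => basisVec p :=
    orthonormal_basisVec.comp _ Fin.val_injective
  refine ContinuousLinearMap.opNorm_le_bound _ hK fun ξ => ?_
  set w := blockOperator (x.map (matrixMap y)) ξ
  have hb : ∀ v : PiLp 2 fun _ : Fin m => Ell2,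
      √(∑ t, ∑ q : Fin n, ‖inner ℂ (basisVec q) (v t)‖ ^ 2) ≤ ‖v‖ := by
    intro v
    refine Real.sqrt_le_iff.2 ⟨norm_nonneg _, ?_⟩
    rw [PiLp.norm_sq_eq_of_L2]
    exact Finset.sum_le_sum fun t _ => hon.sum_inner_products_le (v t)
  have key : ‖w‖ ^ 2 ≤ K * (‖w‖ * ‖ξ‖) := by
    have e : ‖w‖ ^ 2 = ‖inner ℂ w w‖ := by
      rw [inner_self_eq_norm_sq_to_K]; simp
    rw [e, inner_blockOperator_matrixMap]
    refine (h _ _).trans ?_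
    gcongr
    · have := hb w
      simpa only [norm_inner_symm] using this
    · exact hb ξ
  by_contra! hlt
  have : 0 < ‖w‖ := lt_of_le_of_lt (by positivity) hlt
  nlinarith

theorem le_operatorMatNorm_matrixMap {m n : ℕ} (y : Matrix (Fin n) (Fin n) Ell2)
    (x : Matrix (Fin m) (Fin m) Ell2) {ζ ξ : Fin m → Fin n → ℂ}
    (hζ : ∑ s, ∑ p, ‖ζ s p‖ ^ 2 ≤ 1) (hξ : ∑ t, ∑ q, ‖ξ t q‖ ^ 2 ≤ 1) :
    ‖∑ s, ∑ t, ∑ p, ∑ q, ζ s p * ξ t q * inner ℂ (y p q) (x s t)‖ ≤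
      operatorMatNorm Ell2 Ell2 m (x.map (matrixMap y)) := by
  have hon : Orthonormal ℂ fun p : Fin n => basisVec p :=
    orthonormal_basisVec.comp _ Fin.val_injective
  have hnorm : ∀ c : Fin n → ℂ, ‖∑ p, c p • basisVec p‖ ^ 2 = ∑ p, ‖c p‖ ^ 2 := by
    intro c
    have h := hon.inner_sum c c Finset.univ
    rw [inner_self_eq_norm_sq_to_K] at h
    have h2 : ((‖∑ p, c p • basisVec p‖ ^ 2 : ℝ) : ℂ) = ((∑ p, ‖c p‖ ^ 2 : ℝ) : ℂ) := by
      push_cast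
      rw [show ((‖∑ p, c p • basisVec p‖ : ℝ) : ℂ) ^ 2 = _ from h]
      refine Finset.sum_congr rfl fun p _ => ?_
      rw [mul_comm, Complex.mul_conj, Complex.normSq_eq_norm_sq]; push_cast; rfl
    exact_mod_cast h2
  set v : (Fin m → Fin n → ℂ) → PiLp 2 fun _ : Fin m => Ell2 :=
    fun c => WithLp.toLp 2 fun s => ∑ p, c s p • basisVec p
  have hv : ∀ c, ‖v c‖ ^ 2 = ∑ s, ∑ p, ‖c s p‖ ^ 2 := by
    intro c
    rw [PiLp.norm_sq_eq_of_L2]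
    exact Finset.sum_congr rfl fun s _ => hnorm _
  have hv1 : ∀ c, ∑ s, ∑ p, ‖c s p‖ ^ 2 ≤ 1 → ‖v c‖ ≤ 1 := by
    intro c hc
    rw [← hv] at hc
    exact (sq_le_one_iff₀ (norm_nonneg _)).1 hc
  have hin : ∀ (c : Fin m → Fin n → ℂ) (s : Fin m) (q : Fin n),
      inner ℂ (basisVec q) (v c s) = c s q := by
    intro c s q
    exact hon.inner_right_fintype _ _
  set ζ' : Fin m → Fin n → ℂ := fun s p => (starRingEnd ℂ) (ζ s p)
  have hin' : ∀ s p, inner ℂ (v ζ' s) (basisVec (p : Fin n)) = ζ s p := by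
    intro s p
    rw [← inner_conj_symm, hin]; simp [ζ']
  have e := inner_blockOperator_matrixMap y x (v ζ') (v ξ)
  simp only [hin, hin'] at e
  rw [← e]
  calc _ ≤ ‖v ζ'‖ * ‖blockOperator (x.map (matrixMap y)) (v ξ)‖ := norm_inner_le_norm _ _
    _ ≤ 1 * (‖blockOperator (x.map (matrixMap y))‖ * 1) := by
        refine mul_le_mul (hv1 _ (by simpa [ζ'] using hζ)) ?_ (norm_nonneg _) zero_le_one
        exact (ContinuousLinearMap.le_opNorm _ _).trans
          (mul_le_mul_of_nonneg_left (hv1 _ hξ) (norm_nonneg _))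
    _ = _ := by rw [one_mul, mul_one]; rfl

/-- A balanced matrix with constant `1` defines a complete contraction on `[R, C]_θ`: the
analytic functions `y(z) = a^((1-z-θ)/2) x b^((z+θ-1)/2)` interpolate between the pairings of
`R` with `C` and of `C` with `R`. -/
theorem IsBalanced.isCompletelyContractive {n : ℕ} {x : Matrix (Fin n) (Fin n) Ell2} {θ : ℝ}
    (h0 : 0 ≤ θ) (h1 : θ ≤ 1) {a b : Fin n → ℝ} (h : IsBalanced θ x a b 1) :
    IsCompletelyContractive (interpolation θ row column) (operatorMatNorm Ell2 Ell2)
      (matrixMap (balancedFun θ a b x (1 - θ))) := by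
  intro m X
  refine le_of_forall_gt fun M hM => ?_
  obtain ⟨M', hM', hlt⟩ := exists_between hM
  refine lt_of_le_of_lt ?_ hlt
  have hM0 : 0 ≤ M' := (interpolation_nonneg _ _ _ _).trans hM'.le
  obtain ⟨f, hf, hf0, hf1, rfl⟩ := exists_isStripFunction hM'
  refine operatorMatNorm_matrixMap_le hM0 fun ζ ξ => ?_
  -- `y(z̄)`, which enters the pairing antilinearly
  set Φ : ℂ → ℂ := fun z => ∑ s, ∑ t, ∑ p, ∑ q, ζ s p * ξ t q *
    inner ℂ (balancedFun θ a b x (1 - (starRingEnd ℂ) z) p q) (f z s t)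
  set α : Fin n → Fin n → ℝ := fun p q => (Real.log (b q) - Real.log (a p)) / 2 * θ
  set β : Fin n → Fin n → ℝ := fun p q => (Real.log (a p) - Real.log (b q)) / 2
  have hΦ : Φ = fun z => ∑ s, ∑ t, ∑ p, ∑ q, ζ s p * ξ t q *
      (Complex.exp (α p q + β p q * (1 - z)) * innerSL ℂ (x p q) (f z s t)) := by
    funext z
    refine Finset.sum_congr rfl fun s _ => Finset.sum_congr rfl fun t _ =>
      Finset.sum_congr rfl fun p _ => Finset.sum_congr rfl fun q _ => ?_
    rw [balancedFun, Matrix.of_apply, inner_smul_left, ← Complex.exp_conj]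
    simp only [map_add, map_mul, map_sub, map_one, Complex.conj_ofReal, Complex.conj_conj]
    rfl
  have hfin : ∀ t : ℝ, RowLE (f (t * Complex.I)) M' := fun t => (row_le_iff hM0).1 (hf0 t)
  have hfin' : ∀ t : ℝ, RowLE (f (1 + t * Complex.I)).transpose M' :=
    fun t => (column_le_iff hM0).1 (hf1 t)
  have key := norm_le_of_strip (f := Φ) (M := M' * (√(∑ s, ∑ p, ‖ζ s p‖ ^ 2) *
    √(∑ t, ∑ q, ‖ξ t q‖ ^ 2))) ?_ ?_ ?_ ?_ ?_ (ofReal_mem_closedStrip h0 h1)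
  · simpa [Φ] using key
  · rw [hΦ]
    refine continuousOn_finsetSum _ fun s _ => continuousOn_finsetSum _ fun t _ =>
      continuousOn_finsetSum _ fun p _ => continuousOn_finsetSum _ fun q _ => ?_
    refine continuousOn_const.mul (ContinuousOn.mul (by fun_prop) ?_)
    exact (innerSL ℂ (x p q)).continuous.comp_continuousOn (hf.continuousOn s t)
  · rw [hΦ]
    refine DifferentiableOn.fun_sum fun s _ => DifferentiableOn.fun_sum fun t _ =>
      DifferentiableOn.fun_sum fun p _ => DifferentiableOn.fun_sum fun q _ => ?_
    refine DifferentiableOn.const_mul (DifferentiableOn.mul (by fun_prop) ?_) _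
    exact (innerSL ℂ (x p q)).differentiable.comp_differentiableOn (hf.differentiableOn s t)
  · choose B hB using hf.bounded
    refine ⟨∑ s, ∑ t, ∑ p, ∑ q, ‖ζ s p * ξ t q‖ *
      (Real.exp (|α p q| + |β p q|) * (‖innerSL ℂ (x p q)‖ * B s t)), fun z hz => ?_⟩
    rw [hΦ]
    refine (norm_sum_le _ _).trans (Finset.sum_le_sum fun s _ => ?_)
    refine (norm_sum_le _ _).trans (Finset.sum_le_sum fun t _ => ?_)
    refine (norm_sum_le _ _).trans (Finset.sum_le_sum fun p _ => ?_)
    refine (norm_sum_le _ _).trans (Finset.sum_le_sum fun q _ => ?_)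
    have hz' : 1 - z ∈ closedStrip := by
      simp only [closedStrip, Set.mem_ofPred_eq, Complex.sub_re, Complex.one_re] at hz ⊢
      constructor <;> linarith [hz.1, hz.2]
    rw [norm_mul, norm_mul (Complex.exp _)]
    refine mul_le_mul_of_nonneg_left ?_ (norm_nonneg _)
    refine mul_le_mul (norm_cexp_affine_le _ _ hz') ?_ (norm_nonneg _) (by positivity)
    exact (ContinuousLinearMap.le_opNorm _ _).trans
      (mul_le_mul_of_nonneg_left (hB s t z hz) (norm_nonneg _))
  · intro t
    have hy := h.rowLE_right t
    rw [Real.sqrt_one] at hy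
    have := norm_pairing_le hM0 zero_le_one (hfin t) hy ζ ξ
    rw [mul_one] at this
    simpa [Φ] using this
  · intro t
    have hy := h.rowLE_left t
    rw [Real.sqrt_one] at hy
    have := norm_pairing_le hM0 zero_le_one (hfin' t) (y := (balancedFun θ a b x
      (t * Complex.I)).transpose) hy ξ ζ
    rw [mul_one, mul_comm √_] at this
    refine le_trans (le_of_eq ?_) this
    congr 1
    simp only [Φ, map_add, map_one, map_mul, Complex.conj_ofReal, Complex.conj_I,
      Matrix.transpose_apply]
    rw [Finset.sum_comm]
    refine Finset.sum_congr rfl fun t' _ => Finset.sum_congr rfl fun s _ => ?_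
    rw [Finset.sum_comm]
    refine Finset.sum_congr rfl fun q _ => Finset.sum_congr rfl fun p _ => ?_
    rw [mul_comm (ζ s p), show (1 : ℂ) - (1 + t * -Complex.I) = t * Complex.I by ring]

/-- The operator space `X` is normed by its complete contractions into `B(ℓ₂)`. -/
def IsNormed {V : Type*} [AddCommGroup V] [Module ℂ V] (X : MatNorm V) : Prop :=
  ∀ (n : ℕ) (x : Matrix (Fin n) (Fin n) V) (ε : ℝ), 0 < ε →
    ∃ u : V →ₗ[ℂ] (Ell2 →L[ℂ] Ell2), IsCompletelyContractive X (operatorMatNorm Ell2 Ell2) u ∧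
      X n x ≤ operatorMatNorm Ell2 Ell2 n (x.map u) + ε

theorem operatorMatNorm_zero {V : Type*} [AddCommGroup V] [Module ℂ V] {n : ℕ}
    (x : Matrix (Fin n) (Fin n) V) :
    operatorMatNorm Ell2 Ell2 n (x.map (0 : V →ₗ[ℂ] (Ell2 →L[ℂ] Ell2))) = 0 := by
  have : blockOperator (x.map (0 : V →ₗ[ℂ] (Ell2 →L[ℂ] Ell2))) = 0 := by
    ext y i
    simp [blockOperator_apply]
  rw [operatorMatNorm, this, norm_zero]

theorem isCompletelyContractive_zero {V : Type*} [AddCommGroup V] [Module ℂ V] {X : MatNorm V}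
    (hX : ∀ n x, 0 ≤ X n x) :
    IsCompletelyContractive X (operatorMatNorm Ell2 Ell2) (0 : V →ₗ[ℂ] (Ell2 →L[ℂ] Ell2)) :=
  fun n x => by rw [operatorMatNorm_zero]; exact hX n x

/-- A balanced form `z = U x V` of `x`, paired with itself, gives `∑ a^(1-θ) b^θ ‖z‖²`, which is
close to the square of the norm of `x`. -/
theorem isNormed_interpolation {θ : ℝ} (h0 : 0 < θ) (h1 : θ < 1) :
    IsNormed (interpolation θ row column) := by
  intro n x ε hε
  set K := interpolation θ row column n x
  rcases le_or_gt K ε with hK | hK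
  · refine ⟨0, isCompletelyContractive_zero fun _ _ => interpolation_nonneg _ _ _ _, ?_⟩
    rw [operatorMatNorm_zero]; linarith
  obtain ⟨U, hU, V, hV, a, b, N, hbal, hsa, hsb, -, hN⟩ :=
    (dominated_interpolation h0.le h1.le x).exists_isBalanced h0 h1 (pow_pos hε 2)
  have hKN : K ≤ √N := hbal.interpolation_le hU hV
  have hr : 0 < √N := lt_of_lt_of_le (hε.trans hK) hKN
  have hsq : √N ^ 2 = N := Real.sq_sqrt hbal.nonneg
  have hbal1 := hbal.smul (√N)⁻¹
  have e1 : (√N)⁻¹ ^ 2 * N = 1 := by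
    rw [inv_pow, hsq, inv_mul_cancel₀]
    rw [← hsq]; positivity
  rw [e1] at hbal1
  refine ⟨_, hbal1.isCompletelyContractive h0.le h1.le, ?_⟩
  set z := sandwich U V x
  set y := balancedFun θ a b ((((√N)⁻¹ : ℝ) : ℂ) • z) (1 - θ)
  -- test vectors which turn the pairing with `x` into `(√N)⁻¹ ∑ a^(1-θ) b^θ ‖z‖²`
  have hlow := le_operatorMatNorm_matrixMap y x (ζ := fun s p => U p s * (√(a p) : ℝ))
    (ξ := fun t q => V t q * (√(b q) : ℝ)) ?_ ?_
  · have hval : ∑ s, ∑ t, ∑ p, ∑ q, (U p s * (√(a p) : ℝ)) * (V t q * (√(b q) : ℝ)) *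
        inner ℂ (y p q) (x s t)
        = (((√N)⁻¹ * ∑ p, ∑ q, a p ^ (1 - θ) * b q ^ θ * ‖z p q‖ ^ 2 : ℝ) : ℂ) := by
      have e2 : ∀ p q, ∑ t, ∑ s, (U p s * (√(a p) : ℝ)) * (V t q * (√(b q) : ℝ)) *
          inner ℂ (y p q) (x s t) =
            (((√N)⁻¹ * (a p ^ (1 - θ) * b q ^ θ * ‖z p q‖ ^ 2) : ℝ) : ℂ) := by
        intro p q
        have e3 : ∑ t, ∑ s, (U p s * (√(a p) : ℝ)) * (V t q * (√(b q) : ℝ)) *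
            inner ℂ (y p q) (x s t) = (√(a p) : ℝ) * (√(b q) : ℝ) * inner ℂ (y p q) (z p q) := by
          simp only [z, sandwich_apply, inner_sum, inner_smul_right, Finset.mul_sum]
          exact Finset.sum_congr rfl fun t _ => Finset.sum_congr rfl fun s _ => by ring
        have e4 : y p q = ((Real.exp ((Real.log (b q) - Real.log (a p)) / 2 * θ +
            (Real.log (a p) - Real.log (b q)) / 2 * (1 - θ)) * (√N)⁻¹ : ℝ) : ℂ) • z p q := by
          simp only [y, balancedFun, Matrix.of_apply, Matrix.smul_apply, smul_smul]
          congr 1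
          push_cast
          rfl
        have e5 : √(a p) * √(b q) * Real.exp ((Real.log (b q) - Real.log (a p)) / 2 * θ +
            (Real.log (a p) - Real.log (b q)) / 2 * (1 - θ)) = a p ^ (1 - θ) * b q ^ θ := by
          rw [Real.sqrt_eq_rpow, Real.sqrt_eq_rpow, Real.rpow_def_of_pos (hbal.pos_left p),
            Real.rpow_def_of_pos (hbal.pos_right q), Real.rpow_def_of_pos (hbal.pos_left p),
            Real.rpow_def_of_pos (hbal.pos_right q), ← Real.exp_add, ← Real.exp_add,
            ← Real.exp_add]
          congr 1; ring
        rw [e3, e4, inner_smul_left, Complex.conj_ofReal, inner_self_eq_norm_sq_to_K, ← e5]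
        push_cast
        simp only [Complex.coe_algebraMap]
        ring
      calc _ = ∑ p, ∑ q, ∑ t, ∑ s, (U p s * (√(a p) : ℝ)) * (V t q * (√(b q) : ℝ)) *
            inner ℂ (y p q) (x s t) := by
            rw [Finset.sum_congr rfl fun s _ => Finset.sum_comm, Finset.sum_comm]
            refine Finset.sum_congr rfl fun p _ => ?_
            rw [Finset.sum_congr rfl fun s _ => Finset.sum_comm, Finset.sum_comm]
            exact Finset.sum_congr rfl fun q _ => Finset.sum_comm
        _ = _ := by
            simp only [e2, Finset.mul_sum, Complex.ofReal_sum]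
    rw [hval, Complex.norm_real] at hlow
    have h3 := (le_abs_self _).trans hlow
    have h4 : (√N)⁻¹ * (N - ε ^ 2) ≤ operatorMatNorm Ell2 Ell2 n (x.map (matrixMap y)) :=
      (mul_le_mul_of_nonneg_left hN (by positivity)).trans h3
    have h5 : √N - ε ≤ (√N)⁻¹ * (N - ε ^ 2) := by
      have : ε ≤ √N := hK.le.trans hKN
      rw [inv_mul_eq_div, le_div_iff₀ hr]
      nlinarith
    linarith
  · rw [Finset.sum_comm]
    refine le_trans (le_of_eq ?_) hsa
    refine Finset.sum_congr rfl fun p _ => ?_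
    simp only [norm_mul, mul_pow, Complex.norm_real, Real.norm_eq_abs, sq_abs,
      Real.sq_sqrt (hbal.pos_left p).le]
    rw [← Finset.sum_mul, sum_norm_sq_row_eq_one hU, one_mul]
  · rw [Finset.sum_comm]
    refine le_trans (le_of_eq ?_) hsb
    refine Finset.sum_congr rfl fun q _ => ?_
    simp only [norm_mul, mul_pow, Complex.norm_real, Real.norm_eq_abs, sq_abs,
      Real.sq_sqrt (hbal.pos_right q).le]
    rw [← Finset.sum_mul]
    have := sum_norm_sq_row_eq_one (transpose_mem_unitaryGroup hV) q
    simp only [Matrix.transpose_apply] at this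
    rw [this, one_mul]

/-! ### The end points of the interpolation scale -/

theorem RowLE.smul {n : ℕ} {E : Type*} [NormedAddCommGroup E] [InnerProductSpace ℂ E]
    {x : Matrix (Fin n) (Fin n) E} {K : ℝ} (h : RowLE x K) (c : ℂ) : RowLE (c • x) (‖c‖ * K) := by
  intro ξ
  simp only [Matrix.smul_apply, smul_comm _ c]
  simp only [← Finset.smul_sum, norm_smul, mul_pow]
  rw [← Finset.mul_sum, mul_assoc]
  exact mul_le_mul_of_nonneg_left (h ξ) (sq_nonneg _)

theorem row_smul_le {n : ℕ} (c : ℂ) (x : Matrix (Fin n) (Fin n) Ell2) :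
    row n (c • x) ≤ ‖c‖ * row n x :=
  (row_le_iff (mul_nonneg (norm_nonneg _) (row_nonneg _ _))).2
    (((row_le_iff (row_nonneg _ _)).1 le_rfl).smul c)

theorem column_smul_le {n : ℕ} (c : ℂ) (x : Matrix (Fin n) (Fin n) Ell2) :
    column n (c • x) ≤ ‖c‖ * column n x :=
  (column_le_iff (mul_nonneg (norm_nonneg _) (column_nonneg _ _))).2
    (((column_le_iff (column_nonneg _ _)).1 le_rfl).smul c)

/-- At an end point of the scale, interpolation returns the end space. -/
theorem interpolation_zero {V : Type*} [NormedAddCommGroup V] [NormedSpace ℂ V]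
    {X₀ X₁ : MatNorm V} (h₀ : ∀ n x, 0 ≤ X₀ n x)
    (hs₀ : ∀ (n : ℕ) (c : ℂ) (x : Matrix (Fin n) (Fin n) V), X₀ n (c • x) ≤ ‖c‖ * X₀ n x)
    (hs₁ : ∀ (n : ℕ) (c : ℂ) (x : Matrix (Fin n) (Fin n) V), X₁ n (c • x) ≤ ‖c‖ * X₁ n x) :
    interpolation 0 X₀ X₁ = X₀ := by
  funext n x
  apply le_antisymm
  · refine le_of_forall_pos_le_add fun ε hε => ?_
    -- damp the constant function by `e^(-Kz)`, with `K` large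
    obtain ⟨K, hK⟩ : ∃ K : ℝ, X₁ n x / ε ≤ Real.exp K :=
      ⟨_, (le_add_of_nonneg_right zero_le_one).trans (Real.add_one_le_exp _)⟩
    have hg : IsStripFunction fun z : ℂ =>
        (Complex.exp ((0 : ℝ) + (-K : ℝ) * z) • x : Matrix (Fin n) (Fin n) V) := by
      refine ⟨fun i j => ?_, fun i j => ?_,
        fun i j => ⟨Real.exp (|0| + |-K|) * ‖x i j‖, fun z hz => ?_⟩⟩
      · simp only [Matrix.smul_apply]; fun_prop
      · simp only [Matrix.smul_apply]; fun_prop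
      · rw [Matrix.smul_apply, norm_smul]
        exact mul_le_mul_of_nonneg_right (norm_cexp_affine_le _ _ hz) (norm_nonneg _)
    have := interpolation_le (θ := 0) (X₀ := X₀) (X₁ := X₁) hg
      (add_nonneg (h₀ n x) hε.le) (fun t => ?_) (fun t => ?_)
    · simpa using this
    · refine (hs₀ _ _ _).trans ?_
      rw [norm_cexp_affine_left, Real.exp_zero, one_mul]
      linarith
    · refine (hs₁ _ _ _).trans ?_
      rw [norm_cexp_affine_right, zero_add, Real.exp_neg, inv_mul_eq_div,
        div_le_iff₀ (Real.exp_pos K)]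
      rw [div_le_iff₀ hε] at hK
      nlinarith [h₀ n x, Real.exp_pos K, mul_nonneg (h₀ n x) (Real.exp_pos K).le]
  · refine le_of_forall_gt fun M hM => ?_
    obtain ⟨M', hM', hlt⟩ := exists_between hM
    obtain ⟨f, -, hf0, -, rfl⟩ := exists_isStripFunction hM'
    refine lt_of_le_of_lt ?_ hlt
    simpa using hf0 0

theorem interpolation_row_column_zero : interpolation 0 row column = row :=
  interpolation_zero row_nonneg (fun _ => row_smul_le) fun _ => column_smul_le

theorem interpolation_row_column_one : interpolation 1 row column = column := by
  have := interpolation_one_sub 0 column row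
  rw [sub_zero] at this
  rw [this]
  exact interpolation_zero column_nonneg (fun _ => column_smul_le) fun _ => row_smul_le

theorem norm_basisVec (k : ℕ) : ‖basisVec k‖ = 1 := orthonormal_basisVec.1 k

theorem isNormed_row : IsNormed row := by
  set u : Ell2 →ₗ[ℂ] (Ell2 →L[ℂ] Ell2) :=
    { toFun := fun h => (rowOperator h).smulRight (basisVec 0)
      map_add' := fun g h => by
        ext1 v
        simp [rowOperator, add_smul]
      map_smul' := fun c h => by
        ext1 v
        simp [rowOperator, smul_smul] }
  have hu : ∀ (n : ℕ) (x : Matrix (Fin n) (Fin n) Ell2),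
      operatorMatNorm Ell2 Ell2 n (x.map u) = row n x := by
    intro n x
    have e : ∀ y, ‖blockOperator (x.map u) y‖ = ‖blockOperator (x.map rowOperator) y‖ := by
      intro y
      refine (sq_eq_sq₀ (norm_nonneg _) (norm_nonneg _)).1 ?_
      rw [norm_sq_blockOperator, norm_sq_blockOperator]
      refine Finset.sum_congr rfl fun i _ => ?_
      simp [u, ← Finset.sum_smul, norm_smul, norm_basisVec]
    exact le_antisymm
      (ContinuousLinearMap.opNorm_le_bound _ (norm_nonneg _) fun y => by
        rw [e]; exact ContinuousLinearMap.le_opNorm _ _)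
      (ContinuousLinearMap.opNorm_le_bound _ (norm_nonneg _) fun y => by
        rw [← e]; exact ContinuousLinearMap.le_opNorm _ _)
  exact fun n x ε hε => ⟨u, fun m y => (hu m y).le, by rw [hu]; linarith⟩

theorem isNormed_column : IsNormed column := by
  set u : Ell2 →ₗ[ℂ] (Ell2 →L[ℂ] Ell2) :=
    { toFun := fun h => (innerSL ℂ (basisVec 0)).smulRight h
      map_add' := fun g h => by ext1 v; simp
      map_smul' := fun c h => by ext1 v; simp [smul_comm c] }
  have hu : ∀ (n : ℕ) (x : Matrix (Fin n) (Fin n) Ell2),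
      operatorMatNorm Ell2 Ell2 n (x.map u) = column n x := by
    intro n x
    apply le_antisymm
    · refine ContinuousLinearMap.opNorm_le_bound _ (norm_nonneg _) fun y => ?_
      set c : PiLp 2 fun _ : Fin n => ℂ := WithLp.toLp 2 fun j => inner ℂ (basisVec 0) (y j)
      have e : ‖blockOperator (x.map u) y‖ = ‖blockOperator (x.map columnOperator) c‖ := by
        refine (sq_eq_sq₀ (norm_nonneg _) (norm_nonneg _)).1 ?_
        rw [norm_sq_blockOperator, norm_sq_blockOperator]
        refine Finset.sum_congr rfl fun i _ => ?_
        simp [u, c, columnOperator]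
      have hc : ‖c‖ ≤ ‖y‖ := by
        refine (sq_le_sq₀ (norm_nonneg _) (norm_nonneg _)).1 ?_
        rw [PiLp.norm_sq_eq_of_L2, PiLp.norm_sq_eq_of_L2]
        refine Finset.sum_le_sum fun j _ => pow_le_pow_left₀ (norm_nonneg _) ?_ 2
        refine (norm_inner_le_norm _ _).trans ?_
        rw [norm_basisVec, one_mul]
      rw [e]
      exact (ContinuousLinearMap.le_opNorm _ _).trans
        (mul_le_mul_of_nonneg_left hc (norm_nonneg _))
    · refine ContinuousLinearMap.opNorm_le_bound _ (norm_nonneg _) fun c => ?_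
      set y : PiLp 2 fun _ : Fin n => Ell2 := WithLp.toLp 2 fun j => c j • basisVec 0
      have e : ‖blockOperator (x.map u) y‖ = ‖blockOperator (x.map columnOperator) c‖ := by
        refine (sq_eq_sq₀ (norm_nonneg _) (norm_nonneg _)).1 ?_
        rw [norm_sq_blockOperator, norm_sq_blockOperator]
        refine Finset.sum_congr rfl fun i _ => ?_
        simp [u, y, columnOperator, norm_basisVec, inner_self_eq_norm_sq_to_K]
      have hc : ‖y‖ = ‖c‖ := by
        refine (sq_eq_sq₀ (norm_nonneg _) (norm_nonneg _)).1 ?_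
        rw [PiLp.norm_sq_eq_of_L2, PiLp.norm_sq_eq_of_L2]
        exact Finset.sum_congr rfl fun j _ => by simp [y, norm_smul, norm_basisVec]
      rw [← e, ← hc]
      exact ContinuousLinearMap.le_opNorm _ _
  exact fun n x ε hε => ⟨u, fun m y => (hu m y).le, by rw [hu]; linarith⟩

theorem isNormed_interpolation_of_mem {θ : ℝ} (h0 : 0 ≤ θ) (h1 : θ ≤ 1) :
    IsNormed (interpolation θ row column) := by
  rcases h0.eq_or_lt with rfl | h0
  · rw [interpolation_row_column_zero]; exact isNormed_row
  rcases h1.eq_or_lt with rfl | h1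
  · rw [interpolation_row_column_one]; exact isNormed_column
  exact isNormed_interpolation h0 h1

/-! ### The direct sum `X ⊕₂ Y` -/

section DirectSum

theorem blockOperator_add {H K : Type*} [NormedAddCommGroup H] [InnerProductSpace ℂ H]
    [NormedAddCommGroup K] [InnerProductSpace ℂ K] {n : ℕ}
    (S T : Matrix (Fin n) (Fin n) (H →L[ℂ] K)) :
    blockOperator (S + T) = blockOperator S + blockOperator T := by
  ext y i
  simp [blockOperator_apply, Finset.sum_add_distrib]

variable {V W : Type*} [AddCommGroup V] [Module ℂ V] [AddCommGroup W] [Module ℂ W]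
  {X : MatNorm V} {Y : MatNorm W} {n : ℕ}

theorem operatorMatNorm_le_add {u : V →ₗ[ℂ] (Ell2 →L[ℂ] Ell2)} {v : W →ₗ[ℂ] (Ell2 →L[ℂ] Ell2)}
    (hu : IsCompletelyContractive X (operatorMatNorm Ell2 Ell2) u)
    (hv : IsCompletelyContractive Y (operatorMatNorm Ell2 Ell2) v)
    (x : Matrix (Fin n) (Fin n) (V × W)) :
    operatorMatNorm Ell2 Ell2 n (x.map fun a => u a.1 + v a.2)
      ≤ X n (x.map Prod.fst) + Y n (x.map Prod.snd) := by
  have e : (x.map fun a => u a.1 + v a.2)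
      = (x.map Prod.fst).map u + (x.map Prod.snd).map v := by ext; simp
  rw [e, operatorMatNorm, blockOperator_add]
  exact (norm_add_le _ _).trans (add_le_add (hu n _) (hv n _))

theorem directSumOne_le (hX : ∀ n x, 0 ≤ X n x) (hY : ∀ n x, 0 ≤ Y n x)
    (x : Matrix (Fin n) (Fin n) (V × W)) :
    directSumOne X Y n x ≤ X n (x.map Prod.fst) + Y n (x.map Prod.snd) := by
  refine Real.sSup_le ?_ (add_nonneg (hX _ _) (hY _ _))
  rintro r ⟨u, v, hu, hv, rfl⟩
  exact operatorMatNorm_le_add hu hv x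

theorem le_directSumOne {u : V →ₗ[ℂ] (Ell2 →L[ℂ] Ell2)} {v : W →ₗ[ℂ] (Ell2 →L[ℂ] Ell2)}
    (hu : IsCompletelyContractive X (operatorMatNorm Ell2 Ell2) u)
    (hv : IsCompletelyContractive Y (operatorMatNorm Ell2 Ell2) v)
    (x : Matrix (Fin n) (Fin n) (V × W)) :
    operatorMatNorm Ell2 Ell2 n (x.map fun a => u a.1 + v a.2) ≤ directSumOne X Y n x := by
  refine le_csSup ⟨X n (x.map Prod.fst) + Y n (x.map Prod.snd), ?_⟩ ⟨u, v, hu, hv, rfl⟩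
  rintro r ⟨u, v, hu, hv, rfl⟩
  exact operatorMatNorm_le_add hu hv x

theorem fst_le_directSumOne (hX : IsNormed X) (hY : ∀ n x, 0 ≤ Y n x)
    (x : Matrix (Fin n) (Fin n) (V × W)) : X n (x.map Prod.fst) ≤ directSumOne X Y n x := by
  refine le_of_forall_pos_le_add fun ε hε => ?_
  obtain ⟨u, hu, hle⟩ := hX n (x.map Prod.fst) ε hε
  have := le_directSumOne hu (isCompletelyContractive_zero hY) x
  have e : (x.map fun a => u a.1 + (0 : W →ₗ[ℂ] (Ell2 →L[ℂ] Ell2)) a.2)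
      = (x.map Prod.fst).map u := by ext; simp
  rw [e] at this
  linarith

theorem snd_le_directSumOne (hX : ∀ n x, 0 ≤ X n x) (hY : IsNormed Y)
    (x : Matrix (Fin n) (Fin n) (V × W)) : Y n (x.map Prod.snd) ≤ directSumOne X Y n x := by
  refine le_of_forall_pos_le_add fun ε hε => ?_
  obtain ⟨v, hv, hle⟩ := hY n (x.map Prod.snd) ε hε
  have := le_directSumOne (isCompletelyContractive_zero hX) hv x
  have e : (x.map fun a => (0 : V →ₗ[ℂ] (Ell2 →L[ℂ] Ell2)) a.1 + v a.2)
      = (x.map Prod.snd).map v := by ext; simp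
  rw [e] at this
  linarith

end DirectSum

/-- The norm of `X ⊕₂ Y` is at most the sum of the norms, by interpolating a constant function. -/
theorem directSumTwo_le {V W : Type*} [NormedAddCommGroup V] [NormedSpace ℂ V]
    [NormedAddCommGroup W] [NormedSpace ℂ W] {X : MatNorm V} {Y : MatNorm W}
    (hX : ∀ n x, 0 ≤ X n x) (hY : ∀ n x, 0 ≤ Y n x) {n : ℕ}
    (x : Matrix (Fin n) (Fin n) (V × W)) :
    directSumTwo X Y n x ≤ X n (x.map Prod.fst) + Y n (x.map Prod.snd) :=
  interpolation_le (isStripFunction_const x) (add_nonneg (hX _ _) (hY _ _))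
    (fun _ => max_le (le_add_of_nonneg_right (hY _ _)) (le_add_of_nonneg_left (hX _ _)))
    (fun _ => directSumOne_le hX hY x)

/-- Both summands are dominated by `X ⊕₂ Y`: on the left line by the definition of `X ⊕_∞ Y`, on
the right line since `X ⊕₁ Y` dominates spaces normed by complete contractions. -/
theorem dominated_directSumTwo {θ₀ θ₁ : ℝ} (h₀ : 0 ≤ θ₀) (h₀' : θ₀ ≤ 1) (h₁ : 0 ≤ θ₁)
    (h₁' : θ₁ ≤ 1) {n : ℕ} (x : Matrix (Fin n) (Fin n) (Ell2 × Ell2)) :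
    Dominated θ₀ (x.map Prod.fst) (directSumTwo (interpolation θ₀ row column)
        (interpolation θ₁ row column) n x) ∧
      Dominated θ₁ (x.map Prod.snd) (directSumTwo (interpolation θ₀ row column)
        (interpolation θ₁ row column) n x) := by
  have hmono : ∀ {θ : ℝ} {y : Matrix (Fin n) (Fin n) Ell2} {M : ℝ}, 0 ≤ θ → θ ≤ 1 →
      interpolation θ row column n y ≤ M → Dominated θ y M := by
    intro θ y M h h' hy U hU V hV a b ha hb hsa hsb
    exact (dominated_interpolation h h' y U hU V hV a b ha hb hsa hsb).trans
      (pow_le_pow_left₀ (interpolation_nonneg _ _ _ _) hy 2)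
  constructor
  all_goals
    refine Dominated.of_forall_gt fun M hM => ?_
    have hM0 : 0 ≤ M := (interpolation_nonneg _ _ _ _).trans hM.le
    obtain ⟨f, hf, hf0, hf1, rfl⟩ := exists_isStripFunction hM
  · have := (hf.map (ContinuousLinearMap.fst ℂ Ell2 Ell2)).dominated hM0 (θ₀ := θ₀) (θ₁ := θ₀)
      (fun t => hmono h₀ h₀' ((le_max_left _ _).trans (hf0 t)))
      (fun t => hmono h₀ h₀' ((fst_le_directSumOne (isNormed_interpolation_of_mem h₀ h₀')
        (fun _ _ => interpolation_nonneg _ _ _ _) _).trans (hf1 t)))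
      (θ := 1 / 2) (by norm_num) (by norm_num)
    rwa [sub_self, mul_zero, add_zero] at this
  · have := (hf.map (ContinuousLinearMap.snd ℂ Ell2 Ell2)).dominated hM0 (θ₀ := θ₁) (θ₁ := θ₁)
      (fun t => hmono h₁ h₁' ((le_max_right _ _).trans (hf0 t)))
      (fun t => hmono h₁ h₁' ((snd_le_directSumOne (fun _ _ => interpolation_nonneg _ _ _ _)
        (isNormed_interpolation_of_mem h₁ h₁') _).trans (hf1 t)))
      (θ := 1 / 2) (by norm_num) (by norm_num)
    rwa [sub_self, mul_zero, add_zero] at this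

/-- For matrices of size one the trace bound is a bound for the Hilbert space norm. -/
theorem Dominated.norm_le {θ : ℝ} {E : Type*} [NormedAddCommGroup E] [InnerProductSpace ℂ E]
    {v : E} {M : ℝ} (hM : 0 ≤ M)
    (h : Dominated θ (Matrix.of fun _ _ => v : Matrix (Fin 1) (Fin 1) E) M) : ‖v‖ ≤ M := by
  have := h 1 (one_mem _) 1 (one_mem _) (fun _ => 1) (fun _ => 1) (fun _ => one_pos)
    (fun _ => one_pos) (by simp) (by simp)
  rw [sandwich_one] at this
  exact (sq_le_sq₀ (norm_nonneg _) hM).1 (by simpa using this)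

/-! ### Quotients of subspaces -/

section Quotient

variable {V W : Type*} [AddCommGroup V] [Module ℂ V] [AddCommGroup W] [Module ℂ W]

/-- A linear map `Q` from a closed subspace `S` of `Y` to `X` which is completely bounded and
lifts matrices with control of the norm exhibits `X` as a quotient of `S`. -/
theorem isQuotientOfSubspace_of_lift {X : MatNorm V} {Y : MatNorm W} (hX : ∀ n x, 0 ≤ X n x)
    (hX0 : ∀ v : V, X 1 (Matrix.of fun _ _ => v) = 0 → v = 0) (hY : ∀ n x, 0 ≤ Y n x)
    {S : Submodule ℂ W} (hS : IsClosedIn Y S) (Q : S →ₗ[ℂ] V) {C : ℝ} (hC : 0 < C)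
    (hle : ∀ (n : ℕ) (y : Matrix (Fin n) (Fin n) S),
      X n (y.map Q) ≤ C * Y n (y.map fun s => (s : W)))
    (hlift : ∀ (n : ℕ) (x : Matrix (Fin n) (Fin n) V) (ε : ℝ), 0 < ε →
      ∃ y : Matrix (Fin n) (Fin n) S, y.map Q = x ∧ Y n (y.map fun s => (s : W)) ≤ C * X n x + ε) :
    IsQuotientOfSubspace X Y := by
  have hsurj : Function.Surjective Q := by
    intro v
    obtain ⟨y, hy, -⟩ := hlift 1 (Matrix.of fun _ _ => v) 1 one_pos
    exact ⟨y 0 0, congrFun (congrFun hy 0) 0⟩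
  have hker : IsClosedIn (subspaceNorm Y S) (LinearMap.ker Q) := by
    intro s hs
    rw [LinearMap.mem_ker]
    refine hX0 _ (le_antisymm (le_of_forall_pos_le_add fun ε hε => ?_) (hX _ _))
    obtain ⟨s', hs', hlt⟩ := hs (ε / C) (by positivity)
    have h1 := hle 1 (Matrix.of fun _ _ => s - s')
    have h2 : (Matrix.of fun _ _ => s - s' : Matrix (Fin 1) (Fin 1) S).map Q
        = Matrix.of fun _ _ => Q s := by
      ext i j
      simp [LinearMap.mem_ker.1 hs']
    rw [h2] at h1
    have h3 : Y 1 ((Matrix.of fun _ _ => s - s' : Matrix (Fin 1) (Fin 1) S).map fun s => (s : W))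
        < ε / C := hlt
    rw [lt_div_iff₀ hC] at h3
    linarith
  set T : (S ⧸ LinearMap.ker Q) ≃ₗ[ℂ] V := Q.quotKerEquivOfSurjective hsurj
  have hT : ∀ s, T (Submodule.Quotient.mk s) = Q s := fun s => rfl
  refine ⟨S, hS, LinearMap.ker Q, hker, T.symm, ⟨C, fun n x => ?_⟩, ⟨C, fun n z => ?_⟩⟩
  · refine le_of_forall_pos_le_add fun ε hε => ?_
    obtain ⟨y, rfl, hy⟩ := hlift n x ε hε
    refine le_trans (csInf_le ⟨0, ?_⟩ ⟨y, ?_, rfl⟩) hy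
    · rintro r ⟨y, -, rfl⟩
      exact hY _ _
    · ext i j
      change Submodule.Quotient.mk (y i j) = T.symm (Q (y i j))
      rw [← hT, LinearEquiv.symm_apply_apply]
  · rw [← div_le_iff₀' hC]
    refine le_csInf ?_ ?_
    · choose s hs using fun i j => Submodule.mkQ_surjective _ (z i j)
      exact ⟨_, Matrix.of s, by ext i j; exact hs i j, rfl⟩
    · rintro r ⟨y, rfl, rfl⟩
      rw [div_le_iff₀' hC]
      exact hle n y

end Quotient

/-! ### Countably many orthogonal copies of `ℓ₂` in `ℓ₂` -/

/-- Isometric embeddings of `ℓ₂` in `ℓ₂`, indexed by `ℤ`, onto the closed spans of the unit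
vectors in the blocks of a partition of `ℕ ≃ ℤ × ℕ`. -/
def copy (k : ℤ) : Ell2 →ₗᵢ[ℂ] Ell2 :=
  (orthonormal_basisVec.comp (fun i : ℕ => Denumerable.eqv (ℤ × ℕ) (k, i))
    (fun i j h => by simpa using h)).orthogonalFamily.linearIsometry

theorem hasSum_copy (k : ℤ) (h : Ell2) :
    HasSum (fun i : ℕ => h i • basisVec (Denumerable.eqv (ℤ × ℕ) (k, i))) (copy k h) :=
  (orthonormal_basisVec.comp (fun i : ℕ => Denumerable.eqv (ℤ × ℕ) (k, i))
    (fun i j h => by simpa using h)).orthogonalFamily.hasSum_linearIsometry h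

theorem orthogonalFamily_copy : OrthogonalFamily ℂ (fun _ : ℤ => Ell2) copy := by
  intro k m hkm g h
  have h1 : ∀ i : ℕ, inner ℂ (basisVec (Denumerable.eqv (ℤ × ℕ) (k, i))) (copy m h) = 0 := by
    intro i
    refine ((hasSum_copy m h).mapL (innerSL ℂ (basisVec _))).unique ?_
    convert hasSum_zero with j
    rw [innerSL_apply_apply, inner_smul_right, orthonormal_iff_ite.1 orthonormal_basisVec]
    simp [hkm]
  rw [← inner_conj_symm]
  have h2 : inner ℂ (copy m h) (copy k g) = 0 := by
    refine ((hasSum_copy k g).mapL (innerSL ℂ (copy m h))).unique ?_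
    convert hasSum_zero with j
    rw [innerSL_apply_apply, inner_smul_right, ← inner_conj_symm, h1]
    simp
  rw [h2, map_zero]

/-- The coordinate of `ℓ₂` in the copy of `ℓ₂` with index `k`. -/
def coord (k : ℤ) : Ell2 →L[ℂ] Ell2 := ContinuousLinearMap.adjoint (copy k).toContinuousLinearMap

theorem coord_copy (k m : ℤ) (h : Ell2) : coord k (copy m h) = if k = m then h else 0 := by
  refine ext_inner_left ℂ fun g => ?_
  rw [coord, ContinuousLinearMap.adjoint_inner_right]
  change inner ℂ (copy k g) (copy m h) = _
  split_ifs with hkm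
  · subst hkm; exact (copy k).inner_map_map g h
  · rw [inner_zero_right]; exact orthogonalFamily_copy hkm g h

/-- Bessel's inequality for the orthogonal copies of `ℓ₂`. -/
theorem sum_norm_coord_sq_le (F : Finset ℤ) (h : Ell2) :
    ∑ k ∈ F, ‖coord k h‖ ^ 2 ≤ ‖h‖ ^ 2 := by
  set w := ∑ k ∈ F, copy k (coord k h)
  have h1 : ‖w‖ ^ 2 = ∑ k ∈ F, ‖coord k h‖ ^ 2 :=
    orthogonalFamily_copy.norm_sum (fun k => coord k h) F
  have h2 : inner ℂ w h = ((∑ k ∈ F, ‖coord k h‖ ^ 2 : ℝ) : ℂ) := by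
    rw [sum_inner, Complex.ofReal_sum]
    refine Finset.sum_congr rfl fun k _ => ?_
    have : inner ℂ (coord k h) (coord k h) = inner ℂ (copy k (coord k h)) h :=
      ContinuousLinearMap.adjoint_inner_right (copy k).toContinuousLinearMap (coord k h) h
    rw [← this, inner_self_eq_norm_sq_to_K]
    simp
  have h3 : ‖w‖ ^ 2 ≤ ‖w‖ * ‖h‖ := by
    have := norm_inner_le_norm (𝕜 := ℂ) w h
    rwa [h2, ← h1, Complex.norm_real, Real.norm_of_nonneg (by positivity)] at this
  rw [← h1]
  have h4 : ‖w‖ ≤ ‖h‖ := by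
    by_contra! hlt
    have : 0 < ‖w‖ := (norm_nonneg _).trans_lt hlt
    nlinarith
  gcongr

/-- Cutting a matrix along its generalized diagonals `m_j - r_l = k` and placing the pieces in
orthogonal copies of the Hilbert space does not increase the row norm: it replaces `x x*` by its
compression to the blocks on which `m` is constant. -/
theorem RowLE.orthogonal_diagonals {n : ℕ} {E F : Type*} [NormedAddCommGroup E]
    [InnerProductSpace ℂ E] [NormedAddCommGroup F] [InnerProductSpace ℂ F] {J : ℤ → E →ₗᵢ[ℂ] F}
    (hJ : OrthogonalFamily ℂ (fun _ : ℤ => E) J) (m r : Fin n → ℤ)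
    {x : Matrix (Fin n) (Fin n) E} {K : ℝ} (hx : RowLE x K) :
    RowLE (Matrix.of fun j l => J (m j - r l) (x j l)) K := by
  classical
  intro ξ
  set η : ℤ → Fin n → ℂ := fun μ j => if m j = μ then ξ j else 0
  set s : Finset ℤ := Finset.univ.image m
  have hms : ∀ j, m j ∈ s := fun j => Finset.mem_image_of_mem m (Finset.mem_univ j)
  have h1 : ∀ l, ∑ j, ξ j • (Matrix.of fun j l => J (m j - r l) (x j l)) j l
      = ∑ μ ∈ s, J (μ - r l) (∑ j, η μ j • x j l) := by
    intro l
    simp only [map_sum, map_smul, Matrix.of_apply]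
    rw [Finset.sum_comm]
    refine Finset.sum_congr rfl fun j _ => ?_
    rw [Finset.sum_eq_single_of_mem (m j) (hms j)]
    · simp [η]
    · intro μ _ hμ
      simp [η, Ne.symm hμ]
  have h2 : ∀ l, ‖∑ j, ξ j • (Matrix.of fun j l => J (m j - r l) (x j l)) j l‖ ^ 2
      = ∑ μ ∈ s, ‖∑ j, η μ j • x j l‖ ^ 2 := by
    intro l
    rw [h1]
    exact (hJ.comp (sub_left_injective (b := r l))).norm_sum _ s
  have h3 : ∀ j, ∑ μ ∈ s, ‖η μ j‖ ^ 2 = ‖ξ j‖ ^ 2 := by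
    intro j
    rw [Finset.sum_eq_single_of_mem (m j) (hms j)]
    · simp [η]
    · intro μ _ hμ
      simp [η, Ne.symm hμ]
  calc ∑ l, ‖∑ j, ξ j • (Matrix.of fun j l => J (m j - r l) (x j l)) j l‖ ^ 2
      = ∑ μ ∈ s, ∑ l, ‖∑ j, η μ j • x j l‖ ^ 2 := by
        simp only [h2]; rw [Finset.sum_comm]
    _ ≤ ∑ μ ∈ s, K ^ 2 * ∑ j, ‖η μ j‖ ^ 2 := Finset.sum_le_sum fun μ _ => hx _
    _ = K ^ 2 * ∑ j, ‖ξ j‖ ^ 2 := by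
        rw [← Finset.mul_sum, Finset.sum_comm]
        simp only [h3]

/-- The weights of a balanced matrix can be rounded to integral powers of `e`. -/
theorem IsBalanced.exists_round {n : ℕ} {E : Type*} [NormedAddCommGroup E]
    [InnerProductSpace ℂ E] {θ : ℝ} (h0 : 0 ≤ θ) (h1 : θ ≤ 1) {x : Matrix (Fin n) (Fin n) E}
    {a b : Fin n → ℝ} {N : ℝ} (h : IsBalanced θ x a b N) :
    ∃ m r : Fin n → ℤ, IsBalanced θ x (fun j => Real.exp (m j)) (fun l => Real.exp (r l))
      (Real.exp 1 * N) := by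
  have hlow : ∀ {c s : ℝ}, 0 < c → 0 ≤ s → Real.exp ⌊Real.log c⌋ ^ s ≤ c ^ s := by
    intro c s hc hs
    refine Real.rpow_le_rpow (Real.exp_pos _).le ?_ hs
    rw [← Real.le_log_iff_exp_le hc]
    exact Int.floor_le _
  have hup : ∀ {c s : ℝ}, 0 < c → 0 ≤ s → s ≤ 1 →
      c ^ s ≤ Real.exp 1 * Real.exp ⌊Real.log c⌋ ^ s := by
    intro c s hc hs hs1
    rw [← Real.exp_mul, ← Real.exp_add, Real.rpow_def_of_pos hc]
    refine Real.exp_le_exp.2 ?_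
    have := (Int.lt_floor_add_one (Real.log c)).le
    nlinarith
  refine ⟨fun j => ⌊Real.log (a j)⌋, fun l => ⌊Real.log (b l)⌋, fun _ => Real.exp_pos _,
    fun _ => Real.exp_pos _, mul_nonneg (Real.exp_pos _).le h.nonneg, fun ξ => ?_, fun ξ => ?_⟩
  · calc _ ≤ ∑ l, b l ^ θ * ‖∑ j, ξ j • x j l‖ ^ 2 := by
          exact Finset.sum_le_sum fun l _ =>
            mul_le_mul_of_nonneg_right (hlow (h.pos_right l) h0) (sq_nonneg _)
      _ ≤ N * ∑ j, a j ^ θ * ‖ξ j‖ ^ 2 := h.row_le ξ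
      _ ≤ N * ∑ j, (Real.exp 1 * Real.exp ⌊Real.log (a j)⌋ ^ θ) * ‖ξ j‖ ^ 2 := by
          have := h.nonneg
          gcongr with j
          exact hup (h.pos_left j) h0 h1
      _ = _ := by simp only [mul_assoc, ← Finset.mul_sum]; ring
  · calc _ ≤ ∑ j, a j ^ (1 - θ) * ‖∑ l, ξ l • x j l‖ ^ 2 := by
          exact Finset.sum_le_sum fun j _ =>
            mul_le_mul_of_nonneg_right (hlow (h.pos_left j) (by linarith)) (sq_nonneg _)
      _ ≤ N * ∑ l, b l ^ (1 - θ) * ‖ξ l‖ ^ 2 := h.column_le ξ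
      _ ≤ N * ∑ l, (Real.exp 1 * Real.exp ⌊Real.log (b l)⌋ ^ (1 - θ)) * ‖ξ l‖ ^ 2 := by
          have := h.nonneg
          gcongr with l
          exact hup (h.pos_right l) (by linarith) (by linarith)
      _ = _ := by simp only [mul_assoc, ← Finset.mul_sum]; ring

/-! ### The discrete `J`-method -/

/-- The coordinate of index `k`, rescaled by `e^(-kδ)`. -/
def scaledCoord (δ : ℝ) (k : ℤ) : Ell2 →L[ℂ] Ell2 := ((Real.exp (-(k * δ)) : ℝ) : ℂ) • coord k

theorem norm_scaledCoord (δ : ℝ) (k : ℤ) (h : Ell2) :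
    ‖scaledCoord δ k h‖ = Real.exp (-(k * δ)) * ‖coord k h‖ := by
  rw [scaledCoord, smul_apply, norm_smul, Complex.norm_real,
    Real.norm_of_nonneg (Real.exp_pos _).le]

/-- The space of sequences `(c_k)` in `ℓ₂` for which `(e^(kδ₀) c_k)` and `(e^(kδ₁) c_k)` are square
summable, as the subspace of these pairs in `ℓ₂(ℤ; ℓ₂) × ℓ₂(ℤ; ℓ₂) = ℓ₂ × ℓ₂`. -/
def jointSpace (δ₀ δ₁ : ℝ) : Submodule ℂ (Ell2 × Ell2) :=
  ⨅ k : ℤ, LinearMap.eqLocus ((scaledCoord δ₀ k).toLinearMap ∘ₗ LinearMap.fst ℂ Ell2 Ell2)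
    ((scaledCoord δ₁ k).toLinearMap ∘ₗ LinearMap.snd ℂ Ell2 Ell2)

theorem mem_jointSpace {δ₀ δ₁ : ℝ} {w : Ell2 × Ell2} :
    w ∈ jointSpace δ₀ δ₁ ↔ ∀ k, scaledCoord δ₀ k w.1 = scaledCoord δ₁ k w.2 := by
  simp [jointSpace, Submodule.mem_iInf]

theorem isClosed_jointSpace (δ₀ δ₁ : ℝ) : IsClosed (jointSpace δ₀ δ₁ : Set (Ell2 × Ell2)) := by
  have : (jointSpace δ₀ δ₁ : Set (Ell2 × Ell2))
      = ⋂ k, {w | scaledCoord δ₀ k w.1 = scaledCoord δ₁ k w.2} := by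
    ext w; simp [mem_jointSpace]
  rw [this]
  exact isClosed_iInter fun k => isClosed_eq (by fun_prop) (by fun_prop)

/-- The two exponentials dominate on the two halves of `ℤ`, so that the sum is bounded by two
geometric series; shifting `k` by the integral part of `τ` makes the bound independent of `τ`. -/
theorem exists_sum_inv_le_of_neg {s t : ℝ} (hs : s < 0) (ht : 0 < t) :
    ∃ C : ℝ, 0 < C ∧ ∀ (τ : ℝ) (F : Finset ℤ),
      ∑ k ∈ F, (Real.exp (s * (τ + k)) + Real.exp (t * (τ + k)))⁻¹ ≤ C := by
  set d := min t (-s)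
  have hd : 0 < d := lt_min ht (by linarith)
  set ρ := Real.exp (-d)
  have hρ1 : ρ < 1 := (Real.exp_lt_exp.2 (by linarith : -d < 0)).trans_eq Real.exp_zero
  have hsum : Summable fun k : ℤ => Real.exp (-s) * ρ ^ k.natAbs := by
    refine Summable.mul_left _ (Summable.of_nat_of_neg ?_ ?_)
    · simpa only [Int.natAbs_natCast] using summable_geometric_of_lt_one (Real.exp_pos _).le hρ1
    · simpa only [Int.natAbs_neg, Int.natAbs_natCast] using
        summable_geometric_of_lt_one (Real.exp_pos _).le hρ1
  have hnn : ∀ k : ℤ, 0 < Real.exp (-s) * ρ ^ k.natAbs := fun k => by positivity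
  refine ⟨∑' k : ℤ, Real.exp (-s) * ρ ^ k.natAbs, hsum.tsum_pos (fun k => (hnn k).le) 0 (hnn 0),
    fun τ F => ?_⟩
  have hterm : ∀ k : ℤ, (Real.exp (s * (τ + k)) + Real.exp (t * (τ + k)))⁻¹
      ≤ Real.exp (-s) * ρ ^ (k + ⌊τ⌋).natAbs := by
    intro k
    have hf := Int.floor_le τ
    have hf' := (Int.lt_floor_add_one τ).le
    have hρ : ∀ i : ℕ, Real.exp (-s) * ρ ^ i = Real.exp (-s - d * i) := by
      intro i
      rw [← Real.exp_nat_mul, ← Real.exp_add]; congr 1; ring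
    rw [hρ]
    rcases le_or_gt 0 (k + ⌊τ⌋) with hk | hk
    · have hc : (((k + ⌊τ⌋).natAbs : ℕ) : ℝ) = k + ⌊τ⌋ := by
        rw [Nat.cast_natAbs, abs_of_nonneg hk, Int.cast_add]
      have hk' : (0 : ℝ) ≤ k + ⌊τ⌋ := by exact_mod_cast hk
      calc _ ≤ (Real.exp (t * (τ + k)))⁻¹ :=
            inv_anti₀ (Real.exp_pos _) (le_add_of_nonneg_left (Real.exp_pos _).le)
        _ = Real.exp (-(t * (τ + k))) := (Real.exp_neg _).symm
        _ ≤ _ := by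
            refine Real.exp_le_exp.2 ?_
            rw [hc]
            have := min_le_left t (-s)
            nlinarith
    · have hc : (((k + ⌊τ⌋).natAbs : ℕ) : ℝ) = -(k + ⌊τ⌋) := by
        rw [Nat.cast_natAbs, abs_of_neg hk, Int.cast_neg, Int.cast_add]
      have hk' : (k : ℝ) + ⌊τ⌋ < 0 := by exact_mod_cast hk
      calc _ ≤ (Real.exp (s * (τ + k)))⁻¹ :=
            inv_anti₀ (Real.exp_pos _) (le_add_of_nonneg_right (Real.exp_pos _).le)
        _ = Real.exp (-(s * (τ + k))) := (Real.exp_neg _).symm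
        _ ≤ _ := by
            refine Real.exp_le_exp.2 ?_
            rw [hc]
            have := min_le_right t (-s)
            nlinarith
  calc _ ≤ ∑ k ∈ F, Real.exp (-s) * ρ ^ (k + ⌊τ⌋).natAbs := Finset.sum_le_sum fun k _ => hterm k
    _ = ∑ k ∈ F.map (Equiv.addRight ⌊τ⌋).toEmbedding, Real.exp (-s) * ρ ^ k.natAbs := by
        rw [Finset.sum_map]; rfl
    _ ≤ _ := hsum.sum_le_tsum _ fun k _ => (hnn k).le

theorem exists_sum_inv_le {s t : ℝ} (hst : s * t < 0) :
    ∃ C : ℝ, 0 < C ∧ ∀ (τ : ℝ) (F : Finset ℤ),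
      ∑ k ∈ F, (Real.exp (s * (τ + k)) + Real.exp (t * (τ + k)))⁻¹ ≤ C := by
  rcases mul_neg_iff.1 hst with ⟨hs, ht⟩ | ⟨hs, ht⟩
  · simp only [add_comm (Real.exp (s * _))]
    exact exists_sum_inv_le_of_neg ht hs
  · exact exists_sum_inv_le_of_neg hs ht

/-- The constant in the summability estimate of the `J`-method, which does not depend on the
relative scaling `e^τ` of the two norms. -/
theorem exists_sum_norm_scaledCoord_le {δ₀ δ₁ : ℝ} (hδ : δ₀ * δ₁ < 0) :
    ∃ C : ℝ, 0 < C ∧ ∀ w ∈ jointSpace δ₀ δ₁, ∀ (τ : ℝ) (F : Finset ℤ),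
      (∑ k ∈ F, ‖scaledCoord δ₀ k w.1‖) ^ 2 ≤
        C * (Real.exp (2 * δ₀ * τ) * ‖w.1‖ ^ 2 + Real.exp (2 * δ₁ * τ) * ‖w.2‖ ^ 2) := by
  obtain ⟨C, hC, hle⟩ := exists_sum_inv_le (s := 2 * δ₀) (t := 2 * δ₁) (by nlinarith)
  refine ⟨C, hC, fun w hw τ F => ?_⟩
  set g : ℤ → ℝ := fun k => Real.exp (2 * δ₀ * (τ + k)) + Real.exp (2 * δ₁ * (τ + k))
  have hg : ∀ k, 0 < g k := fun k => by positivity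
  have hcs := Finset.sum_sq_le_sum_mul_sum_of_sq_le_mul F
    (r := fun k => ‖scaledCoord δ₀ k w.1‖) (f := fun k => (g k)⁻¹)
    (g := fun k => g k * ‖scaledCoord δ₀ k w.1‖ ^ 2)
    (fun k _ => (inv_pos.2 (hg k)).le) (fun k _ => by have := hg k; positivity)
    (fun k _ => by rw [inv_mul_cancel_left₀ (hg k).ne'])
  have hexp : ∀ (δ : ℝ) (k : ℤ) (h : Ell2), Real.exp (2 * δ * (τ + k)) * ‖scaledCoord δ k h‖ ^ 2
      = Real.exp (2 * δ * τ) * ‖coord k h‖ ^ 2 := by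
    intro δ k h
    rw [norm_scaledCoord, mul_pow, ← mul_assoc, ← Real.exp_nat_mul, ← Real.exp_add]
    congr 2; push_cast; ring
  have hsum : ∑ k ∈ F, g k * ‖scaledCoord δ₀ k w.1‖ ^ 2 ≤
      Real.exp (2 * δ₀ * τ) * ‖w.1‖ ^ 2 + Real.exp (2 * δ₁ * τ) * ‖w.2‖ ^ 2 := by
    calc _ = ∑ k ∈ F, (Real.exp (2 * δ₀ * τ) * ‖coord k w.1‖ ^ 2
          + Real.exp (2 * δ₁ * τ) * ‖coord k w.2‖ ^ 2) := by
          refine Finset.sum_congr rfl fun k _ => ?_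
          rw [add_mul, hexp, mem_jointSpace.1 hw k, hexp]
      _ = Real.exp (2 * δ₀ * τ) * ∑ k ∈ F, ‖coord k w.1‖ ^ 2
          + Real.exp (2 * δ₁ * τ) * ∑ k ∈ F, ‖coord k w.2‖ ^ 2 := by
          rw [Finset.sum_add_distrib, Finset.mul_sum, Finset.mul_sum]
      _ ≤ _ := by
          gcongr
          · exact sum_norm_coord_sq_le F _
          · exact sum_norm_coord_sq_le F _
  refine hcs.trans (mul_le_mul (hle τ F) hsum ?_ hC.le)
  exact Finset.sum_nonneg fun k _ => by have := hg k; positivity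

theorem summable_scaledCoord {δ₀ δ₁ : ℝ} (hδ : δ₀ * δ₁ < 0) {w : Ell2 × Ell2}
    (hw : w ∈ jointSpace δ₀ δ₁) : Summable fun k => ‖scaledCoord δ₀ k w.1‖ := by
  obtain ⟨C, hC, hle⟩ := exists_sum_norm_scaledCoord_le hδ
  refine summable_of_sum_le (fun _ => norm_nonneg _) (c := √(C * (Real.exp (2 * δ₀ * 0) * ‖w.1‖ ^ 2
    + Real.exp (2 * δ₁ * 0) * ‖w.2‖ ^ 2))) fun F => ?_
  exact Real.le_sqrt_of_sq_le (hle w hw 0 F)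

/-- The sum map `(c_k) ↦ ∑ c_k` of the `J`-method. -/
def jointSum {δ₀ δ₁ : ℝ} (hδ : δ₀ * δ₁ < 0) : jointSpace δ₀ δ₁ →ₗ[ℂ] Ell2 where
  toFun w := ∑' k, scaledCoord δ₀ k w.1.1
  map_add' v w := by
    rw [← (summable_scaledCoord hδ v.2).of_norm.tsum_add (summable_scaledCoord hδ w.2).of_norm]
    exact tsum_congr fun k => map_add _ _ _
  map_smul' c w := by
    rw [RingHom.id_apply, ← (summable_scaledCoord hδ w.2).of_norm.tsum_const_smul c]
    exact tsum_congr fun k => map_smul _ _ _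

theorem exists_norm_jointSum_sq_le {δ₀ δ₁ : ℝ} (hδ : δ₀ * δ₁ < 0) :
    ∃ C : ℝ, 0 < C ∧ ∀ (w : jointSpace δ₀ δ₁) (τ : ℝ), ‖jointSum hδ w‖ ^ 2 ≤
      C * (Real.exp (2 * δ₀ * τ) * ‖w.1.1‖ ^ 2 + Real.exp (2 * δ₁ * τ) * ‖w.1.2‖ ^ 2) := by
  obtain ⟨C, hC, hle⟩ := exists_sum_norm_scaledCoord_le hδ
  refine ⟨C, hC, fun w τ => ?_⟩
  have hs := summable_scaledCoord hδ w.2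
  have h1 : ‖jointSum hδ w‖ ≤ ∑' k, ‖scaledCoord δ₀ k w.1.1‖ := norm_tsum_le_tsum_norm hs
  have h2 : ∑' k, ‖scaledCoord δ₀ k w.1.1‖ ≤ √(C * (Real.exp (2 * δ₀ * τ) * ‖w.1.1‖ ^ 2
      + Real.exp (2 * δ₁ * τ) * ‖w.1.2‖ ^ 2)) :=
    hs.tsum_le_of_sum_le fun F => Real.le_sqrt_of_sq_le (hle w.1 w.2 τ F)
  calc _ ≤ √(C * (Real.exp (2 * δ₀ * τ) * ‖w.1.1‖ ^ 2
      + Real.exp (2 * δ₁ * τ) * ‖w.1.2‖ ^ 2)) ^ 2 := by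
        gcongr
        exact h1.trans h2
    _ = _ := Real.sq_sqrt (by positivity)

/-- The sum map is bounded for the trace bounds: for each entry this is the estimate of the
`J`-method with `e^τ` the quotient of the two weights of that entry. -/
theorem exists_dominated_jointSum {θ₀ θ₁ η : ℝ} (hδ : (θ₀ - η) / 2 * ((θ₁ - η) / 2) < 0) :
    ∃ C : ℝ, 0 < C ∧ ∀ (n : ℕ)
      (y : Matrix (Fin n) (Fin n) (jointSpace ((θ₀ - η) / 2) ((θ₁ - η) / 2))) (M : ℝ),
      Dominated θ₀ (y.map fun w => w.1.1) M → Dominated θ₁ (y.map fun w => w.1.2) M →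
      Dominated η (y.map (jointSum hδ)) (C * M) := by
  obtain ⟨C, hC, hle⟩ := exists_norm_jointSum_sq_le hδ
  refine ⟨√(2 * C), by positivity, fun n y M h₀ h₁ U hU V hV a b ha hb hsa hsb => ?_⟩
  have e0 : sandwich U V (y.map fun w => w.1.1) = (sandwich U V y).map fun w => w.1.1 :=
    (map_sandwich (LinearMap.fst ℂ Ell2 Ell2 ∘ₗ (jointSpace _ _).subtype) U V y).symm
  have e1 : sandwich U V (y.map fun w => w.1.2) = (sandwich U V y).map fun w => w.1.2 :=
    (map_sandwich (LinearMap.snd ℂ Ell2 Ell2 ∘ₗ (jointSpace _ _).subtype) U V y).symm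
  have h₀' := h₀ U hU V hV a b ha hb hsa hsb
  have h₁' := h₁ U hU V hV a b ha hb hsa hsb
  rw [e0] at h₀'
  rw [e1] at h₁'
  rw [← map_sandwich]
  have hw : ∀ (θ : ℝ) (j l : Fin n), a j ^ (1 - η) * b l ^ η *
      Real.exp (2 * ((θ - η) / 2) * (Real.log (b l) - Real.log (a j)))
        = a j ^ (1 - θ) * b l ^ θ := by
    intro θ j l
    rw [Real.rpow_def_of_pos (ha j), Real.rpow_def_of_pos (hb l), Real.rpow_def_of_pos (ha j),
      Real.rpow_def_of_pos (hb l), ← Real.exp_add, ← Real.exp_add, ← Real.exp_add]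
    congr 1; ring
  calc _ ≤ ∑ j, ∑ l, (C * (a j ^ (1 - θ₀) * b l ^ θ₀ * ‖(sandwich U V y j l).1.1‖ ^ 2)
        + C * (a j ^ (1 - θ₁) * b l ^ θ₁ * ‖(sandwich U V y j l).1.2‖ ^ 2)) := by
        refine Finset.sum_le_sum fun j _ => Finset.sum_le_sum fun l _ => ?_
        have hp : 0 ≤ a j ^ (1 - η) * b l ^ η :=
          mul_nonneg (Real.rpow_nonneg (ha j).le _) (Real.rpow_nonneg (hb l).le _)
        have := mul_le_mul_of_nonneg_left
          (hle (sandwich U V y j l) (Real.log (b l) - Real.log (a j))) hp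
        refine this.trans (le_of_eq ?_)
        rw [← hw θ₀, ← hw θ₁]
        ring
    _ = C * (∑ j, ∑ l, a j ^ (1 - θ₀) * b l ^ θ₀ * ‖(sandwich U V y j l).1.1‖ ^ 2)
        + C * (∑ j, ∑ l, a j ^ (1 - θ₁) * b l ^ θ₁ * ‖(sandwich U V y j l).1.2‖ ^ 2) := by
        simp only [Finset.sum_add_distrib, Finset.mul_sum]
    _ ≤ C * M ^ 2 + C * M ^ 2 := by
        gcongr
        · exact h₀'
        · exact h₁'
    _ = (√(2 * C) * M) ^ 2 := by
        rw [mul_pow, Real.sq_sqrt (by positivity)]; ring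

/-- A matrix balanced by integral powers of `e` lifts to the space of the `J`-method: its
coordinate of index `k` is the generalized diagonal `m_j - r_l = k`. -/
theorem IsBalanced.exists_lift {n : ℕ} {x : Matrix (Fin n) (Fin n) Ell2}
    {U V : Matrix (Fin n) (Fin n) ℂ}
    (hU : U ∈ Matrix.unitaryGroup (Fin n) ℂ) (hV : V ∈ Matrix.unitaryGroup (Fin n) ℂ)
    {θ₀ θ₁ η : ℝ} (hδ : (θ₀ - η) / 2 * ((θ₁ - η) / 2) < 0) {m r : Fin n → ℤ} {N : ℝ}
    (h : IsBalanced η (sandwich U V x) (fun j => Real.exp (m j)) (fun l => Real.exp (r l)) N) :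
    ∃ y : Matrix (Fin n) (Fin n) (jointSpace ((θ₀ - η) / 2) ((θ₁ - η) / 2)),
      y.map (jointSum hδ) = x ∧
      interpolation θ₀ row column n (y.map fun w => w.1.1) ≤ √N ∧
      interpolation θ₁ row column n (y.map fun w => w.1.2) ≤ √N := by
  set z := sandwich U V x
  set f := balancedFun η (fun j => Real.exp (m j)) (fun l => Real.exp (r l)) z
  set W : ℂ → Matrix (Fin n) (Fin n) Ell2 :=
    fun ζ => Matrix.of fun j l => copy (m j - r l) (f ζ j l)
  have hf : IsStripFunction f := isStripFunction_balancedFun _ _ _ _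
  have hW : IsStripFunction W := by
    refine ⟨fun j l => ?_, fun j l => ?_, fun j l => ?_⟩
    · exact (copy (m j - r l)).continuous.comp_continuousOn (hf.continuousOn j l)
    · exact (copy (m j - r l)).toContinuousLinearMap.differentiable.comp_differentiableOn
        (hf.differentiableOn j l)
    · obtain ⟨B, hB⟩ := hf.bounded j l
      exact ⟨B, fun ζ hζ => by
        simp only [W, Matrix.of_apply, LinearIsometry.norm_map]; exact hB ζ hζ⟩
  have hW0 : ∀ t : ℝ, RowLE (W (t * Complex.I)) √N := fun t =>
    (h.rowLE_left t).orthogonal_diagonals orthogonalFamily_copy m r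
  have hW1 : ∀ t : ℝ, RowLE (W (1 + t * Complex.I)).transpose √N := by
    intro t
    have := (h.rowLE_right t).orthogonal_diagonals
      (orthogonalFamily_copy.comp (f := fun k : ℤ => -k) neg_injective) r m
    convert this using 1
    ext l j
    simp [W, f]
  have hval : ∀ (θ : ℝ) (j l : Fin n),
      f θ j l = ((Real.exp (((m j - r l : ℤ) : ℝ) * ((θ - η) / 2)) : ℝ) : ℂ) • z j l := by
    intro θ j l
    simp only [f, balancedFun, Matrix.of_apply, Real.log_exp]
    congr 1
    push_cast
    congr 1
    ring
  have hcoord : ∀ (θ : ℝ) (k : ℤ) (j l : Fin n),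
      scaledCoord ((θ - η) / 2) k (W θ j l) = if k = m j - r l then z j l else 0 := by
    intro θ k j l
    simp only [W, Matrix.of_apply, scaledCoord, smul_apply, coord_copy, hval]
    split_ifs with hk
    · rw [hk, smul_smul, ← Complex.ofReal_mul, ← Real.exp_add, neg_add_cancel, Real.exp_zero,
        Complex.ofReal_one, one_smul]
    · rw [smul_zero]
  set S := jointSpace ((θ₀ - η) / 2) ((θ₁ - η) / 2)
  set Y : Matrix (Fin n) (Fin n) S := Matrix.of fun j l =>
    ⟨(W θ₀ j l, W θ₁ j l), mem_jointSpace.2 fun k => by rw [hcoord, hcoord]⟩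
  have hYQ : Y.map (jointSum hδ) = z := by
    ext1 j l
    change ∑' k, scaledCoord ((θ₀ - η) / 2) k (W θ₀ j l) = z j l
    simp only [hcoord]
    exact tsum_ite_eq _ _
  have e0 : (sandwich (star U) (star V) Y).map (fun w => w.1.1)
      = sandwich (star U) (star V) (W θ₀) :=
    map_sandwich (LinearMap.fst ℂ Ell2 Ell2 ∘ₗ S.subtype) _ _ Y
  have e1 : (sandwich (star U) (star V) Y).map (fun w => w.1.2)
      = sandwich (star U) (star V) (W θ₁) :=
    map_sandwich (LinearMap.snd ℂ Ell2 Ell2 ∘ₗ S.subtype) _ _ Y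
  refine ⟨sandwich (star U) (star V) Y, ?_, ?_, ?_⟩
  · rw [map_sandwich, hYQ, sandwich_star_sandwich hU hV]
  · rw [e0]
    exact interpolation_sandwich_le (star_mem_unitaryGroup hU) (star_mem_unitaryGroup hV) hW
      (Real.sqrt_nonneg _) hW0 hW1
  · rw [e1]
    exact interpolation_sandwich_le (star_mem_unitaryGroup hU) (star_mem_unitaryGroup hV) hW
      (Real.sqrt_nonneg _) hW0 hW1

/-! ### Intermediate spaces as quotients of subspaces -/

theorem eq_zero_of_interpolation_eq_zero {η : ℝ} (h0 : 0 ≤ η) (h1 : η ≤ 1) (v : Ell2)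
    (hv : interpolation η row column 1 (Matrix.of fun _ _ => v) = 0) : v = 0 := by
  have := (dominated_interpolation h0 h1 (Matrix.of fun _ _ => v)).norm_le
    (interpolation_nonneg _ _ _ _)
  rw [hv] at this
  exact norm_le_zero_iff.1 this

/-- The norm of `[R, C]_{θ₀} ⊕₂ [R, C]_{θ₁}` dominates the norm of `ℓ₂ × ℓ₂`. -/
theorem isClosedIn_directSumTwo {θ₀ θ₁ : ℝ} (h₀ : 0 ≤ θ₀) (h₀' : θ₀ ≤ 1) (h₁ : 0 ≤ θ₁)
    (h₁' : θ₁ ≤ 1) {S : Submodule ℂ (Ell2 × Ell2)} (hS : IsClosed (S : Set (Ell2 × Ell2))) :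
    IsClosedIn (directSumTwo (interpolation θ₀ row column) (interpolation θ₁ row column)) S := by
  intro v hv
  rw [← SetLike.mem_coe, ← hS.closure_eq, Metric.mem_closure_iff]
  intro ε hε
  obtain ⟨s, hs, hlt⟩ := hv ε hε
  refine ⟨s, hs, ?_⟩
  obtain ⟨d0, d1⟩ := dominated_directSumTwo h₀ h₀' h₁ h₁'
    (Matrix.of fun _ _ => v - s : Matrix (Fin 1) (Fin 1) (Ell2 × Ell2))
  rw [dist_eq_norm]
  refine lt_of_le_of_lt ?_ hlt
  exact max_le (Dominated.norm_le (interpolation_nonneg _ _ _ _) d0)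
    (Dominated.norm_le (interpolation_nonneg _ _ _ _) d1)

/-- A space of the scale strictly between two others is a quotient of a subspace of their sum. -/
theorem isQuotientOfSubspace_interpolation {θ₀ θ₁ η : ℝ} (h₀ : 0 ≤ θ₀) (h₀' : θ₀ ≤ 1)
    (h₁ : 0 ≤ θ₁) (h₁' : θ₁ ≤ 1) (hη : 0 < η) (hη' : η < 1)
    (hδ : (θ₀ - η) * (θ₁ - η) < 0) :
    IsQuotientOfSubspace (interpolation η row column)
      (directSumTwo (interpolation θ₀ row column) (interpolation θ₁ row column)) := by
  have hδ' : (θ₀ - η) / 2 * ((θ₁ - η) / 2) < 0 := by linarith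
  obtain ⟨C, hC, hdom⟩ := exists_dominated_jointSum hδ'
  set Y := directSumTwo (interpolation θ₀ row column) (interpolation θ₁ row column)
  have hY : ∀ n x, 0 ≤ Y n x := fun _ _ => interpolation_nonneg _ _ _ _
  set D := max C (2 * √(Real.exp 1))
  refine isQuotientOfSubspace_of_lift (fun _ _ => interpolation_nonneg _ _ _ _)
    (fun v => eq_zero_of_interpolation_eq_zero hη.le hη'.le v) hY
    (isClosedIn_directSumTwo h₀ h₀' h₁ h₁' (isClosed_jointSpace _ _)) (jointSum hδ')
    (C := D) (lt_max_of_lt_left hC) (fun n y => ?_) (fun n x ε hε => ?_)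
  · obtain ⟨d0, d1⟩ := dominated_directSumTwo h₀ h₀' h₁ h₁' (y.map fun s => (s : Ell2 × Ell2))
    refine ((hdom n y _ d0 d1).interpolation_le hη hη' (mul_nonneg hC.le (hY _ _))).trans ?_
    exact mul_le_mul_of_nonneg_right (le_max_left _ _) (hY _ _)
  · set K := interpolation η row column n x
    have hK : 0 ≤ K := interpolation_nonneg _ _ _ _
    set e := 2 * √(Real.exp 1)
    have he : 0 < e := by positivity
    obtain ⟨U, hU, V, hV, a, b, N, hbal, -, -, hN, -⟩ :=
      (dominated_interpolation hη.le hη'.le x).exists_isBalanced hη hη' (pow_pos (div_pos hε he) 2)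
    obtain ⟨m, r, hbal'⟩ := hbal.exists_round hη.le hη'.le
    obtain ⟨y, hy, hy0, hy1⟩ := hbal'.exists_lift hU hV hδ'
    refine ⟨y, hy, ?_⟩
    have hsqrt : √(Real.exp 1 * N) ≤ √(Real.exp 1) * (K + ε / e) := by
      rw [Real.sqrt_mul (Real.exp_pos _).le]
      gcongr
      refine Real.sqrt_le_iff.2 ⟨by positivity, hN.trans ?_⟩
      have : 0 ≤ K * (ε / e) := by positivity
      nlinarith
    have hsum := directSumTwo_le (X := interpolation θ₀ row column)
      (Y := interpolation θ₁ row column) (fun _ _ => interpolation_nonneg _ _ _ _)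
      (fun _ _ => interpolation_nonneg _ _ _ _) (y.map fun s => (s : Ell2 × Ell2))
    calc Y n (y.map fun s => (s : Ell2 × Ell2)) ≤ √(Real.exp 1 * N) + √(Real.exp 1 * N) :=
          hsum.trans (add_le_add hy0 hy1)
      _ ≤ e * (K + ε / e) := by simp only [e] at hsqrt ⊢; linarith
      _ = e * K + ε := by field_simp
      _ ≤ D * K + ε := by gcongr; exact le_max_right _ _

theorem interpolation_apply_zero (θ : ℝ) (n : ℕ) :
    interpolation θ row column n (0 : Matrix (Fin n) (Fin n) Ell2) = 0 := by
  refine le_antisymm ?_ (interpolation_nonneg _ _ _ _)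
  have h : RowLE (0 : Matrix (Fin n) (Fin n) Ell2) 0 := by intro ξ; simp
  exact interpolation_le (isStripFunction_const 0) le_rfl (fun _ => (row_le_iff le_rfl).2 h)
    (fun _ => (column_le_iff le_rfl).2 (by rwa [Matrix.transpose_zero]))

/-- A summand is a quotient of a subspace of the sum: take `S = {0} × ℓ₂` and `N = 0`. -/
theorem isQuotientOfSubspace_right {θ₀ θ₁ : ℝ} (h₀ : 0 ≤ θ₀) (h₀' : θ₀ ≤ 1)
    (h₁ : 0 < θ₁) (h₁' : θ₁ < 1) :
    IsQuotientOfSubspace (interpolation θ₁ row column)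
      (directSumTwo (interpolation θ₀ row column) (interpolation θ₁ row column)) := by
  have hY : ∀ n x,
      0 ≤ directSumTwo (interpolation θ₀ row column) (interpolation θ₁ row column) n x :=
    fun _ _ => interpolation_nonneg _ _ _ _
  set S : Submodule ℂ (Ell2 × Ell2) := LinearMap.ker (LinearMap.fst ℂ Ell2 Ell2)
  have hS : IsClosed (S : Set (Ell2 × Ell2)) :=
    (ContinuousLinearMap.fst ℂ Ell2 Ell2).isClosed_ker
  refine isQuotientOfSubspace_of_lift (fun _ _ => interpolation_nonneg _ _ _ _)
    (fun v => eq_zero_of_interpolation_eq_zero h₁.le h₁'.le v) hY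
    (isClosedIn_directSumTwo h₀ h₀' h₁.le h₁'.le hS) (LinearMap.snd ℂ Ell2 Ell2 ∘ₗ S.subtype)
    one_pos (fun n y => ?_) (fun n x ε hε => ?_)
  · rw [one_mul]
    exact (dominated_directSumTwo h₀ h₀' h₁.le h₁'.le
      (y.map fun s => (s : Ell2 × Ell2))).2.interpolation_le h₁ h₁' (hY _ _)
  · refine ⟨Matrix.of fun i j => ⟨(0, x i j), by simp [S]⟩, rfl, ?_⟩
    refine (directSumTwo_le (fun _ _ => interpolation_nonneg _ _ _ _)
      (fun _ _ => interpolation_nonneg _ _ _ _) _).trans ?_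
    have e := interpolation_apply_zero θ₀ n
    change interpolation θ₀ row column n 0 + interpolation θ₁ row column n x ≤ _
    rw [e]
    linarith

end OpSpace

end

theorem mainTheorem12 (p q : ℝ) (hp : 1 ≤ p) (hpq : p < q) (hq : q ≤ 2) :
    OpSpace.IsQuotientOfSubspace (OpSpace.rowP q)
      (OpSpace.directSumTwo (OpSpace.rowP p) OpSpace.OH) ∧
    OpSpace.IsQuotientOfSubspace (OpSpace.columnP q)
      (OpSpace.directSumTwo (OpSpace.columnP p) OpSpace.OH) := by
  have hp0 : 0 < p := by linarith
  have hq0 : 0 < q := by linarith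
  have h1 : 1 / q < 1 / p := one_div_lt_one_div_of_lt hp0 hpq
  have h2 : 1 / p ≤ 1 := (div_le_one hp0).2 hp
  have h3 : 1 / 2 ≤ 1 / q := one_div_le_one_div_of_le hq0 hq
  have hcol : ∀ s, OpSpace.columnP s
      = OpSpace.interpolation (1 - 1 / s) OpSpace.row OpSpace.column := fun s =>
    (OpSpace.interpolation_one_sub _ _ _).symm
  rw [hcol, hcol]
  simp only [OpSpace.rowP, OpSpace.OH]
  rcases h3.eq_or_lt with h | h
  · rw [← h]
    norm_num only
    exact ⟨OpSpace.isQuotientOfSubspace_right (by linarith) h2 (by norm_num) (by norm_num),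
      OpSpace.isQuotientOfSubspace_right (by linarith) (by linarith) (by norm_num) (by norm_num)⟩
  · exact ⟨OpSpace.isQuotientOfSubspace_interpolation (by linarith) h2 (by norm_num) (by norm_num)
        (by linarith) (by linarith) (by nlinarith),
      OpSpace.isQuotientOfSubspace_interpolation (by linarith) (by linarith) (by norm_num)
        (by norm_num) (by linarith) (by linarith) (by nlinarith)⟩
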